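/- Let $(x,y,z,p,q,r,s,t)$ be the standard coordinates on $J^2(\mathbb{R}^2,\mathbb{R})=\mathbb{R}^8$, and let $F$ be a smooth function on an open subset of $J^2$. Let $i_F:\Sigma_7\to J^2$ be a smooth map from an open set $\Sigma_7\subset\mathbb{R}^7$ into the locus $F=0$, of rank $7$ and everywhere transverse to the fibres of $J^2\to J^1$ (a nondegenerate parametrization). Let $I_F$ be the Pfaffian system on $\Sigma_7$ generated by the pullbacks under $i_F$ of $\theta^1=dz-p\,dx-q\,dy$, $\theta^2=dp-r\,dx-s\,dy$, $\theta^3=dq-s\,dx-t\,dy$, and let $I_F^{(1)}$ be its first derived system. Assume that $F=0$ is hyperbolic, i.e. $\Delta:=F_rF_t-\tfrac14F_s^2<0$ along $i_F$. Then locally $I_F$ has exactly two rank two subsystems $M_1,M_2$ (labelled in either order) that are isotropic for the bilinear form $\langle\varphi,\psi\rangle\,\mathrm{Vol}=d\varphi\wedge d\psi\wedge i_F^*\theta^1\wedge i_F^*\theta^2\wedge i_F^*\theta^3$. Assume that $F=0$ is generic: $M_1$ and $M_2$ both have class $7$ at every point, where the class of a Pfaffian system $M$ is the rank of the annihilator of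 its Cauchy characteristic space $\{X : X\in M^\perp,\ X\lrcorner\, dM\subset M\}$. An adapted coframe with sign $\epsilon\in\{1,-1\}$ on an open set $V\subset\Sigma_7$ is a smooth coframe $\omega^1,\dots,\omega^7$ on $V$ with $I_F=\{\omega^1,\omega^2,\omega^3\}$, $I_F^{(1)}=\{\omega^1\}$, $M_1=\{\omega^1,\omega^2\}$, $M_2=\{\omega^1,\omega^3\}$ (for one of the two labellings) which satisfies the structure equations $$d\omega^1\equiv\omega^3\wedge\omega^6+\omega^2\wedge\omega^4 \mod \{\omega^1\},$$ $$d\omega^2\equiv\omega^4\wedge\omega^5+\omega^3\wedge\omega^7 \mod \{\omega^1,\omega^2\},$$ $$d\omega^3\equiv\omega^6\wedge\omega^7+\epsilon\,\omega^2\wedge\omega^5 \mod \{\omega^1,\omega^3\}.$$ When $F_s\ge 0$ at a point of the locus, put there $\lambda_+=\tfrac12F_s+\sqrt{|\Delta|}$ and $$I_1=\det\begin{pmatrix}F_r&F_s&F_t\\ \lambda_+&F_t&0\\ (F_t/\lambda_+)_r&(F_t/\lambda_+)_s&(F_t/\lambda_+)_t\end{pmatrix},\qquad I_2=\det\begin{pmatrix}0&F_r&\lambda_+\\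 F_r&F_s&F_t\\ (F_r/\lambda_+)_r&(F_r/\lambda_+)_s&(F_r/\lambda_+)_t\end{pmatrix};$$ when $F_s\le 0$, use these formulas with $-F$ in place of $F$ (when $F_s=0$ either choice is allowed). Then: 1. For every $p\in\Sigma_7$ there is exactly one $\epsilon$ such that an adapted coframe with sign $\epsilon$ exists on some neighbourhood of $p$. 2. This sign is a contact invariant: if $\bar F=0$, with parametrization $i_{\bar F}:\bar\Sigma_7\to J^2$, is another such generic hyperbolic equation, $U\subset\Sigma_7$ is open and $\phi:U\to\bar\Sigma_7$ is a local diffeomorphism with $\phi^*I_{\bar F}=I_F$, then for every $p\in U$ the sign of $\bar F=0$ at $\phi(p)$ equals the sign of $F=0$ at $p$. 3. At every $p\in\Sigma_7$ the sign is $\epsilon=\mathrm{sgn}(I_1I_2)$, evaluated at $i_F(p)$. -/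

import Mathlib

open scoped ContDiff

noncomputable section

namespace GenHyp

/-! ### Exterior calculus on the parameter space `ℝ⁷` -/

/-- The ambient space `ℝ⁷` of the parameter domain `Σ₇`. -/
abbrev E7 : Type := Fin 7 → ℝ

/-- The second jet space `J²(ℝ², ℝ)` with its coordinates `(x, y, z, p, q, r, s, t)`
numbered `0, …, 7`. -/
abbrev J2 : Type := Fin 8 → ℝ

/-- Covectors at a point of `ℝ⁷`. -/
abbrev Cov : Type := E7 →L[ℝ] ℝ

/-- The algebra of exterior forms at a point; its product is the wedge product. -/
abbrev Ext : Type := ExteriorAlgebra ℝ Cov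

/-- A covector as an exterior form of degree one. -/
abbrev toExt (ξ : Cov) : Ext := ExteriorAlgebra.ι ℝ ξ

/-- The exterior derivative at `p` of the 1-form `φ = ∑ᵢ φᵢ dxᵢ`, namely `∑ᵢ dφᵢ ∧ dxᵢ`. -/
def d (φ : E7 → Cov) (p : E7) : Ext :=
  ∑ i : Fin 7, toExt (fderiv ℝ (fun x => φ x (Pi.single i 1)) p) *
    toExt (ContinuousLinearMap.proj i)

/-- The algebraic ideal of the exterior algebra generated by a space of covectors.
(A left ideal generated by elements of degree one is two-sided.) -/
def extIdeal (I : Submodule ℝ Cov) : Ideal Ext :=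
  Ideal.span (toExt '' (I : Set Cov))

/-- `Ω ≡ Ω' mod I`. -/
def ModEq (I : Submodule ℝ Cov) (Ω Ω' : Ext) : Prop := Ω - Ω' ∈ extIdeal I

/-- Evaluation of covectors at a tangent vector. -/
def evalAt (X : E7) : Module.Dual ℝ Cov :=
  (ContinuousLinearMap.apply ℝ ℝ X : Cov →L[ℝ] ℝ)

/-- Interior product of a tangent vector and a form. -/
def contract (X : E7) (Ω : Ext) : Ext := CliffordAlgebra.contractLeft (evalAt X) Ω

/-! ### Pfaffian systems -/

/-- A Pfaffian system, given by its fibre at each point. -/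
abbrev Pfaffian : Type := E7 → Submodule ℝ Cov

/-- `φ` is a smooth local section of the Pfaffian system `I` over the open set `U`. -/
structure IsSection (I : Pfaffian) (U : Set E7) (φ : E7 → Cov) : Prop where
  isOpen : IsOpen U
  smooth : ContDiffOn ℝ ∞ φ U
  mem : ∀ x ∈ U, φ x ∈ I x

/-- The fibre at `p` of the first derived system `I⁽¹⁾`: the values at `p` of the local sections
`φ` of `I` with `dφ ≡ 0 mod I`. -/
def derivedAt (I : Pfaffian) (p : E7) : Set Cov :=
  {ξ | ∃ U φ, p ∈ U ∧ IsSection I U φ ∧ (∀ x ∈ U, ModEq (I x) (d φ x) 0) ∧ φ p = ξ}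

/-- The Cauchy characteristic space of `I` at `p`: the vectors `X` annihilated by `I` with
`X ⌟ dI ⊆ I`. -/
def cauchyCharAt (I : Pfaffian) (p : E7) : Set E7 :=
  {X | (∀ ξ ∈ I p, ξ X = 0) ∧
    ∀ U φ, p ∈ U → IsSection I U φ → ∃ η ∈ I p, contract X (d φ p) = toExt η}

/-- The Cartan system of `I` at `p`: the annihilator of the Cauchy characteristic space. -/
def cartanAt (I : Pfaffian) (p : E7) : Submodule ℝ Cov :=
  ⨅ X ∈ cauchyCharAt I p, LinearMap.ker (evalAt X)

/-- The class of `I` at `p`: the rank of the Cartan system. -/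
def classAt (I : Pfaffian) (p : E7) : ℕ := Module.finrank ℝ (cartanAt I p)

/-! ### Second order equations -/

/-- The coordinate differentials on `J²`. -/
def dJ (i : Fin 8) : J2 →L[ℝ] ℝ := ContinuousLinearMap.proj i

/-- The contact forms `θ¹ = dz - p dx - q dy`, `θ² = dp - r dx - s dy`, `θ³ = dq - s dx - t dy`
at the point `w` of `J²`. -/
def theta (w : J2) : Fin 3 → (J2 →L[ℝ] ℝ) :=
  ![dJ 2 - w 3 • dJ 0 - w 4 • dJ 1,
    dJ 3 - w 5 • dJ 0 - w 6 • dJ 1,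
    dJ 4 - w 6 • dJ 0 - w 7 • dJ 1]

/-- The pulled back contact forms `i_F^* θ^α` on the parameter space. -/
def contactForm (iF : E7 → J2) (α : Fin 3) (p : E7) : Cov :=
  (theta (iF p) α).comp (fderiv ℝ iF p)

/-- The Pfaffian system `I_F` generated by the pulled back contact forms. -/
def contactSystem (iF : E7 → J2) : Pfaffian := fun p =>
  Submodule.span ℝ (Set.range fun α => contactForm iF α p)

/-- The projection `J² → J¹` to the coordinates `(x, y, z, p, q)`. -/
def projJ1 : J2 →ₗ[ℝ] (Fin 5 → ℝ) := LinearMap.funLeft ℝ ℝ (Fin.castLE (by norm_num))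

/-- Partial derivative with respect to the `i`-th coordinate of `J²`. -/
def pd (i : Fin 8) (F : J2 → ℝ) (w : J2) : ℝ := fderiv ℝ F w (Pi.single i 1)

/-- `F_r`. -/
abbrev Fr (F : J2 → ℝ) : J2 → ℝ := pd 5 F
/-- `F_s`. -/
abbrev Fs (F : J2 → ℝ) : J2 → ℝ := pd 6 F
/-- `F_t`. -/
abbrev Ft (F : J2 → ℝ) : J2 → ℝ := pd 7 F

/-- `Δ = F_r F_t - F_s² / 4`. -/
def discr (F : J2 → ℝ) (w : J2) : ℝ := Fr F w * Ft F w - 1 / 4 * Fs F w ^ 2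

/-- `λ₊ = F_s / 2 + √|Δ|`. -/
def lamPlus (F : J2 → ℝ) (w : J2) : ℝ := Fs F w / 2 + √|discr F w|

/-- The relative invariant `I₁`, meant at points with `Δ < 0` and `F_s ≥ 0`. -/
def relInv1 (F : J2 → ℝ) (w : J2) : ℝ :=
  let g : J2 → ℝ := fun v => Ft F v / lamPlus F v
  Matrix.det !![Fr F w, Fs F w, Ft F w;
                lamPlus F w, Ft F w, 0;
                pd 5 g w, pd 6 g w, pd 7 g w]

/-- The relative invariant `I₂`, meant at points with `Δ < 0` and `F_s ≥ 0`. -/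
def relInv2 (F : J2 → ℝ) (w : J2) : ℝ :=
  let g : J2 → ℝ := fun v => Fr F v / lamPlus F v
  Matrix.det !![0, Fr F w, lamPlus F w;
                Fr F w, Fs F w, Ft F w;
                pd 5 g w, pd 6 g w, pd 7 g w]

/-- The smooth map `iF : S → J²` on the open set `S ⊆ ℝ⁷` is a nondegenerate parametrization of
(a piece of) the locus `F = 0`, where `F` is smooth on the open set `W ⊆ J²`: it has rank `7` and
its image is everywhere transverse to the fibres of `J² → J¹`. -/
structure IsNondegParam (W : Set J2) (F : J2 → ℝ) (S : Set E7) (iF : E7 → J2) : Prop where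
  isOpen_W : IsOpen W
  smooth_F : ContDiffOn ℝ ∞ F W
  isOpen_S : IsOpen S
  smooth_i : ContDiffOn ℝ ∞ iF S
  maps : Set.MapsTo iF S W
  locus : ∀ p ∈ S, F (iF p) = 0
  rank : ∀ p ∈ S, Function.Injective (fderiv ℝ iF p)
  transverse : ∀ p ∈ S,
    LinearMap.range (fderiv ℝ iF p : E7 →ₗ[ℝ] J2) ⊔ LinearMap.ker projJ1 = ⊤

/-- Vanishing at `p` of the bilinear form `⟨φ, ψ⟩ Vol = dφ ∧ dψ ∧ ω¹ ∧ ω² ∧ ω³` on sections of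
`I_F`, where `ω^α = i_F^* θ^α`. -/
def Orthogonal (iF : E7 → J2) (p : E7) (φ ψ : E7 → Cov) : Prop :=
  d φ p * d ψ p * toExt (contactForm iF 0 p) * toExt (contactForm iF 1 p) *
    toExt (contactForm iF 2 p) = 0

/-- `M` is, over the open set `V`, a (smooth) rank two isotropic subsystem of `I_F`.  For a
hyperbolic equation there are locally exactly two such systems, the characteristic systems
`M₁` and `M₂`. -/
structure IsCharSystem (iF : E7 → J2) (V : Set E7) (M : Pfaffian) : Prop where
  isOpen : IsOpen V
  smooth : ∃ a b : E7 → Cov, ContDiffOn ℝ ∞ a V ∧ ContDiffOn ℝ ∞ b V ∧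
    ∀ p ∈ V, M p = Submodule.span ℝ {a p, b p}
  le : ∀ p ∈ V, M p ≤ contactSystem iF p
  rank : ∀ p ∈ V, Module.finrank ℝ (M p) = 2
  isotropic : ∀ p ∈ V, ∀ U φ ψ, p ∈ U → IsSection (contactSystem iF) U φ →
    IsSection (contactSystem iF) U ψ → φ p ∈ M p → ψ p ∈ M p → Orthogonal iF p φ ψ

/-- `F = 0` is, on the parameter domain `S`, a hyperbolic equation (`Δ < 0`) of generic type
(both characteristic systems have class `7`), with nondegenerate parametrization `iF`. -/
structure IsGenericHyperbolic (W : Set J2) (F : J2 → ℝ) (S : Set E7) (iF : E7 → J2) : Prop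
    extends IsNondegParam W F S iF where
  hyperbolic : ∀ p ∈ S, discr F (iF p) < 0
  generic : ∀ V M, V ⊆ S → IsCharSystem iF V M → ∀ p ∈ V, classAt M p = 7

/-- `om = (ω¹, …, ω⁷)` (numbered `0, …, 6`) is a smooth coframe on the open set `V`, adapted to
`I_F`, its derived system and its two characteristic systems
`M₁ = {ω¹, ω²}`, `M₂ = {ω¹, ω³}`, and satisfying the generic hyperbolic structure equations
with the constant `ε = ±1`. -/
structure IsAdaptedCoframe (iF : E7 → J2) (V : Set E7) (om : Fin 7 → E7 → Cov) (ε : ℝ) :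
    Prop where
  isOpen : IsOpen V
  smooth : ∀ i, ContDiffOn ℝ ∞ (om i) V
  linInd : ∀ p ∈ V, LinearIndependent ℝ fun i => om i p
  sign : ε = 1 ∨ ε = -1
  contact : ∀ p ∈ V, contactSystem iF p = Submodule.span ℝ {om 0 p, om 1 p, om 2 p}
  derived : ∀ p ∈ V, derivedAt (contactSystem iF) p = (Submodule.span ℝ {om 0 p} : Set Cov)
  char₁ : IsCharSystem iF V fun p => Submodule.span ℝ {om 0 p, om 1 p}
  char₂ : IsCharSystem iF V fun p => Submodule.span ℝ {om 0 p, om 2 p}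
  streq₁ : ∀ p ∈ V, ModEq (Submodule.span ℝ {om 0 p}) (d (om 0) p)
    (toExt (om 2 p) * toExt (om 5 p) + toExt (om 1 p) * toExt (om 3 p))
  streq₂ : ∀ p ∈ V, ModEq (Submodule.span ℝ {om 0 p, om 1 p}) (d (om 1) p)
    (toExt (om 3 p) * toExt (om 4 p) + toExt (om 2 p) * toExt (om 6 p))
  streq₃ : ∀ p ∈ V, ModEq (Submodule.span ℝ {om 0 p, om 2 p}) (d (om 2) p)
    (toExt (om 5 p) * toExt (om 6 p) + ε • (toExt (om 1 p) * toExt (om 4 p)))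

/-- `ε` is the sign in the generic hyperbolic structure equations of some adapted coframe
defined near `p`. -/
def IsEpsilonAt (S : Set E7) (iF : E7 → J2) (p : E7) (ε : ℝ) : Prop :=
  ∃ V om, p ∈ V ∧ V ⊆ S ∧ IsAdaptedCoframe iF V om ε

/-- Pullback of covectors by a linear map. -/
def pullCov (A : E7 →L[ℝ] E7) : Cov →ₗ[ℝ] Cov where
  toFun η := η.comp A
  map_add' _ _ := rfl
  map_smul' _ _ := rfl

/-- `Φ : U → S'` is a local contact equivalence, defined on the open set `U ⊆ S`: a local
diffeomorphism with `Φ^* I_{F'} = I_F`. -/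
structure IsContactEquiv (S : Set E7) (iF : E7 → J2) (S' : Set E7) (iF' : E7 → J2)
    (U : Set E7) (Φ : E7 → E7) : Prop where
  isOpen : IsOpen U
  subset : U ⊆ S
  maps : Set.MapsTo Φ U S'
  smooth : ContDiffOn ℝ ∞ Φ U
  localDiffeo : ∀ p ∈ U, Function.Bijective (fderiv ℝ Φ p)
  pullback : ∀ p ∈ U,
    (contactSystem iF' (Φ p)).map (pullCov (fderiv ℝ Φ p)) = contactSystem iF p

end GenHyp

end

open scoped ContDiff

noncomputable section

namespace GenHyp

open Topology Filter

/-! Congruences modulo a Pfaffian system are tested on the vectors it annihilates, so that structure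
equations become numerical identities between `extD` and `wdg` (`modEq_d_iff`).

Uniqueness of the sign: modulo I_F, the differential of any section of I_F is A ω⁴∧ω⁵ + B ω⁶∧ω⁷. It
vanishes for ω¹ and is decomposable, hence AB = 0, for ω² and ω³. So two adapted coframes share the
line of ω¹ and share M₁, M₂ up to exchange (`transition`), and the exchange keeps ε
(`IsWeakCoframe.swap`). If the labellings agree, then modulo ω¹ the forms ω², ω³ are rescaled by
factors a, b, and comparing structure equations gives ε b⁴ = ε' a⁴, so ε = ε' (`sign_eq_of_ne_zero`,
`sign_unique`). Contact invariance follows, since the structure equations pull back.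

Existence and the formula: where F_s ≥ 0, hyperbolicity gives λ₊ > 0, and with g = F_t/λ₊, h =
F_r/λ₊ the symbol of F splits as λ₊ (hξ + η)(ξ + gη). The factors yield the isotropic systems {θ¹,
θ² + gθ³}, {θ¹, hθ² + θ³} and the coframe `charCoframe`, whose structure equations have torsion
terms ω³∧γ and ω²∧δ in place of ω³∧ω⁷ and ε ω²∧ω⁵ (`isTorsionCoframe`). The ω⁷-coefficient of γ and
the ω⁵-coefficient of δ are the same positive multiple of I₁ and I₂ respectively (`torsion_eq`). If
one of them vanished, a characteristic system would have a Cauchy characteristic vector and class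
below 7 (`classAt_ne`). Both being nonzero, the other coefficients can be absorbed and a fourth-root
rescaling leaves ε = sgn(I₁I₂) (`IsTorsionCoframe.exists_isWeakCoframe`). Absorption requires two
cross coefficients to agree, which is the symmetry of the second derivatives of F (`coef_compat`).
The case F_s ≤ 0 is reduced to this one by passing to -F. -/

/-- The value of `a ∧ b` on a pair of vectors. -/
def wdg (a b : Cov) (X Y : E7) : ℝ := a X * b Y - a Y * b X

/-- The value of `dφ` on a pair of vectors. -/
def extD (φ : E7 → Cov) (p X Y : E7) : ℝ := fderiv ℝ φ p X Y - fderiv ℝ φ p Y X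

/-! ### Forms of degree two, and testing ideal membership on vectors -/

/-- Restriction of covectors to a pair of vectors, as odd elements of the exterior algebra of the
plane in its regular representation. -/
def pairLin (X Y : E7) : Cov →ₗ[ℝ] Matrix (Fin 4) (Fin 4) ℝ where
  -- Left multiplication by ξ(X) e₁ + ξ(Y) e₂ in the basis 1, e₁, e₂, e₁∧e₂ of the exterior algebra
  -- of the plane.
  toFun ξ := !![0, 0, 0, 0; ξ X, 0, 0, 0; ξ Y, 0, 0, 0; 0, -ξ Y, ξ X, 0]
  map_add' a b := by
    ext i j; fin_cases i <;> fin_cases j <;> simp [add_comm]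
  map_smul' c a := by
    ext i j; fin_cases i <;> fin_cases j <;> simp

/-- The restriction of exterior forms to a pair of vectors. -/
def pairRep (X Y : E7) : Ext →ₐ[ℝ] Matrix (Fin 4) (Fin 4) ℝ :=
  ExteriorAlgebra.lift ℝ ⟨pairLin X Y, fun ξ => by
    ext i j
    fin_cases i <;> fin_cases j <;>
      (simp [pairLin, Matrix.mul_apply, Fin.sum_univ_four]; try ring)⟩

/-- Evaluation of the degree two part of a form on a pair of vectors. -/
def ev2 (X Y : E7) : Ext →ₗ[ℝ] ℝ where
  -- Entry (3, 0) is the coefficient of e₁∧e₂ in Ω · 1.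
  toFun Ω := pairRep X Y Ω 3 0
  map_add' a b := by simp
  map_smul' c a := by simp

lemma ev2_mul (X Y : E7) (a b : Cov) : ev2 X Y (toExt a * toExt b) = wdg a b X Y := by
  simp [ev2, pairRep, pairLin, wdg, Matrix.mul_apply, Fin.sum_univ_four]
  ring

/-- The kernel of the algebra map `pairRep X Y` is an ideal, so it suffices that it contains the
generators. -/
lemma ev2_eq_zero_of_mem {I : Submodule ℝ Cov} {X Y : E7} (hX : ∀ ξ ∈ I, ξ X = 0)
    (hY : ∀ ξ ∈ I, ξ Y = 0) {Ω : Ext} (h : Ω ∈ extIdeal I) : ev2 X Y Ω = 0 := by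
  have key : extIdeal I ≤ RingHom.ker (pairRep X Y) := by
    refine Ideal.span_le.2 ?_
    rintro _ ⟨ξ, hξ, rfl⟩
    show pairRep X Y (toExt ξ) = 0
    ext i j
    fin_cases i <;> fin_cases j <;> simp [pairRep, pairLin, hX ξ hξ, hY ξ hξ]
  have : pairRep X Y Ω = 0 := key h
  simp [ev2, this]

/-- The space of exterior forms of degree two. -/
def twoForms : Submodule ℝ Ext := Submodule.span ℝ {Ω | ∃ a b : Cov, Ω = toExt a * toExt b}

lemma mul_mem_twoForms (a b : Cov) : toExt a * toExt b ∈ twoForms :=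
  Submodule.subset_span ⟨a, b, rfl⟩

lemma d_mem_twoForms (φ : E7 → Cov) (p : E7) : d φ p ∈ twoForms :=
  Submodule.sum_mem _ fun _ _ => mul_mem_twoForms _ _

lemma toExt_mul_swap (a b : Cov) : toExt a * toExt b = -(toExt b * toExt a) := by
  rw [eq_neg_iff_add_eq_zero]
  exact ExteriorAlgebra.ι_add_mul_swap a b

lemma cov_eq_sum (a : Cov) :
    a = ∑ i : Fin 7, a (Pi.single i 1) • (ContinuousLinearMap.proj i : Cov) := by
  ext X
  conv_lhs => rw [pi_eq_sum_univ' X]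
  simp [mul_comm]

/-- A form of degree two is determined by its values. -/
lemma twoForm_eq_sum {Ω : Ext} (h : Ω ∈ twoForms) :
    (2 : ℝ) • Ω = ∑ i : Fin 7, ∑ j : Fin 7, ev2 (Pi.single i 1) (Pi.single j 1) Ω •
      (toExt (ContinuousLinearMap.proj i) * toExt (ContinuousLinearMap.proj j)) := by
  induction h using Submodule.span_induction with
  | mem x hx =>
    obtain ⟨a, b, rfl⟩ := hx
    have e : ∀ a b : Cov, toExt a * toExt b = ∑ i : Fin 7, ∑ j : Fin 7,
        (a (Pi.single i 1) * b (Pi.single j 1)) •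
        (toExt (ContinuousLinearMap.proj i) * toExt (ContinuousLinearMap.proj j)) := by
      intro a b
      conv_lhs => rw [cov_eq_sum a, cov_eq_sum b]
      simp only [toExt, map_sum, map_smul, Finset.sum_mul, Finset.mul_sum, smul_mul_assoc,
        mul_smul_comm]
      rw [Finset.sum_comm]
      simp only [Finset.smul_sum, smul_smul]
      refine Finset.sum_congr rfl fun i _ => Finset.sum_congr rfl fun j _ => ?_
      rw [mul_comm]
    simp only [ev2_mul, wdg, sub_smul, Finset.sum_sub_distrib]
    rw [two_smul]
    nth_rewrite 2 [toExt_mul_swap]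
    rw [← sub_eq_add_neg, e a b, e b a]
    congr 1
    refine Finset.sum_congr rfl fun i _ => Finset.sum_congr rfl fun j _ => ?_
    rw [mul_comm]
  | zero => simp
  | add x y _ _ hx hy =>
    simp only [smul_add, hx, hy, map_add, add_smul, Finset.sum_add_distrib]
  | smul c x _ hx =>
    rw [smul_comm, hx]
    simp only [map_smul, Finset.smul_sum, smul_smul, smul_eq_mul]

lemma mul_toExt_mem {I : Submodule ℝ Cov} {ξ : Cov} (h : ξ ∈ I) (w : Ext) :
    w * toExt ξ ∈ extIdeal I :=
  Ideal.mul_mem_left _ _ (Ideal.subset_span ⟨ξ, h, rfl⟩)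

/-- `extIdeal I` is stable under right multiplication. -/
lemma extIdeal_mul_right {I : Submodule ℝ Cov} (w : Ext) :
    ∀ x ∈ extIdeal I, x * w ∈ extIdeal I := by
  induction w using ExteriorAlgebra.induction with
  | algebraMap r =>
    intro x h
    rw [← Algebra.commutes]
    exact Ideal.mul_mem_left _ _ h
  | ι a =>
    intro x h
    induction h using Submodule.span_induction with
    | mem x hx =>
      obtain ⟨ξ, hξ, rfl⟩ := hx
      change toExt ξ * toExt a ∈ _
      rw [toExt_mul_swap]
      exact neg_mem (mul_toExt_mem hξ _)
    | zero => simp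
    | add x y _ _ hx hy => rw [add_mul]; exact add_mem hx hy
    | smul c x _ hx =>
      rw [smul_eq_mul, mul_assoc]; exact Ideal.mul_mem_left _ _ hx
  | mul a b ha hb =>
    intro x h
    rw [← mul_assoc]
    exact hb _ (ha x h)
  | add a b ha hb =>
    intro x h
    rw [mul_add]; exact add_mem (ha x h) (hb x h)

lemma smul_mem_extIdeal {I : Submodule ℝ Cov} (c : ℝ) {x : Ext} (h : x ∈ extIdeal I) :
    c • x ∈ extIdeal I := by
  rw [Algebra.smul_def]; exact Ideal.mul_mem_left _ _ h

/-- A form of degree two lies in the ideal generated by `I` as soon as it vanishes on the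
vectors annihilated by `I`. -/
lemma mem_extIdeal_of_ev2 {I : Submodule ℝ Cov} {Ω : Ext} (hΩ : Ω ∈ twoForms)
    (h : ∀ X Y : E7, (∀ ξ ∈ I, ξ X = 0) → (∀ ξ ∈ I, ξ Y = 0) → ev2 X Y Ω = 0) :
    Ω ∈ extIdeal I := by
  obtain ⟨s, hs⟩ := I.mkQ.exists_rightInverse_of_surjective
    (LinearMap.range_eq_top.2 I.mkQ_surjective)
  -- P is a projection of covectors with kernel I, and T below is its transpose, so T takes values
  -- in the vectors annihilated by I. Modulo I, a∧b may be replaced by Pa∧Pb, whose values on basis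
  -- vectors are those of a∧b on their images under T.
  set P : Cov →ₗ[ℝ] Cov := s ∘ₗ I.mkQ with hP
  have hPI : ∀ ξ ∈ I, P ξ = 0 := fun ξ hξ => by
    simp [hP, (Submodule.Quotient.mk_eq_zero I).2 hξ]
  have hsub : ∀ ξ, ξ - P ξ ∈ I := fun ξ => by
    rw [← Submodule.Quotient.mk_eq_zero, Submodule.Quotient.mk_sub, sub_eq_zero]
    exact (LinearMap.congr_fun hs (I.mkQ ξ)).symm
  let T : E7 → E7 := fun X i => P (ContinuousLinearMap.proj i) X
  have hT : ∀ ξ X, ξ (T X) = P ξ X := fun ξ X => by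
    have h2 := congrArg (fun η => P η X) (cov_eq_sum ξ)
    simp only [map_sum, map_smul] at h2
    rw [h2]
    conv_lhs => rw [cov_eq_sum ξ]
    simp [T]
  have key : ∀ Ω ∈ twoForms, (2 : ℝ) • Ω - ∑ i : Fin 7, ∑ j : Fin 7,
      ev2 (T (Pi.single i 1)) (T (Pi.single j 1)) Ω •
      (toExt (ContinuousLinearMap.proj i) * toExt (ContinuousLinearMap.proj j)) ∈ extIdeal I := by
    intro Ω hΩ
    induction hΩ using Submodule.span_induction with
    | mem x hx =>
      obtain ⟨a, b, rfl⟩ := hx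
      have e := twoForm_eq_sum (mul_mem_twoForms (P a) (P b))
      simp only [ev2_mul, wdg, ← hT] at e ⊢
      rw [← e, ← smul_sub]
      refine smul_mem_extIdeal _ ?_
      have : toExt a * toExt b - toExt (P a) * toExt (P b) =
          toExt (a - P a) * toExt b + toExt (P a) * toExt (b - P b) := by
        simp only [toExt, map_sub, sub_mul, mul_sub]; abel
      rw [this]
      exact add_mem (extIdeal_mul_right _ _ (Ideal.subset_span ⟨_, hsub a, rfl⟩))
        (mul_toExt_mem (hsub b) _)
    | zero => simp
    | add x y _ _ hx hy =>
      have := add_mem hx hy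
      simp only [smul_add, map_add, add_smul, Finset.sum_add_distrib]
      convert this using 1; abel
    | smul c x _ hx =>
      have := smul_mem_extIdeal c hx
      simpa only [smul_sub, smul_comm c (2 : ℝ), map_smul, Finset.smul_sum, smul_smul,
        smul_eq_mul] using this
  have h2 := key Ω hΩ
  have hz : ∀ X, ∀ ξ ∈ I, ξ (T X) = 0 := fun X ξ hξ => by rw [hT, hPI ξ hξ]; rfl
  simp only [h _ _ (hz _) (hz _), zero_smul, Finset.sum_const_zero, sub_zero] at h2
  simpa using smul_mem_extIdeal (1 / 2 : ℝ) h2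

lemma modEq_iff {I : Submodule ℝ Cov} {Ω Ω' : Ext} (hΩ : Ω ∈ twoForms) (hΩ' : Ω' ∈ twoForms) :
    ModEq I Ω Ω' ↔ ∀ X Y : E7, (∀ ξ ∈ I, ξ X = 0) → (∀ ξ ∈ I, ξ Y = 0) →
      ev2 X Y Ω = ev2 X Y Ω' := by
  constructor
  · intro h X Y hX hY
    have := ev2_eq_zero_of_mem hX hY h
    rwa [map_sub, sub_eq_zero] at this
  · intro h
    refine mem_extIdeal_of_ev2 (sub_mem hΩ hΩ') fun X Y hX hY => ?_
    rw [map_sub, h X Y hX hY, sub_self]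

lemma fderiv_apply_const {φ : E7 → Cov} {p : E7} (h : DifferentiableAt ℝ φ p) (Z X : E7) :
    fderiv ℝ (fun x => φ x Z) p X = fderiv ℝ φ p X Z := by
  have := (h.hasFDerivAt.clm_apply (hasFDerivAt_const Z p)).fderiv
  rw [this]; simp

lemma contract_toExt_mul (X : E7) (a b : Cov) :
    contract X (toExt a * toExt b) = toExt (a X • b - b X • a) := by
  have h1 := CliffordAlgebra.contractLeft_ι_mul (Q := (0 : QuadraticForm ℝ Cov)) (evalAt X) a
    (CliffordAlgebra.ι _ b)
  rw [CliffordAlgebra.contractLeft_ι] at h1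
  simp only [contract, toExt, ExteriorAlgebra.ι]
  rw [h1, map_sub, map_smul, map_smul, ← Algebra.commutes, ← Algebra.smul_def]
  rfl

lemma ev2_d {φ : E7 → Cov} {p : E7} (h : DifferentiableAt ℝ φ p) (X Y : E7) :
    ev2 X Y (d φ p) = extD φ p X Y := by
  simp only [d, map_sum, ev2_mul, wdg, extD, fderiv_apply_const h, Finset.sum_sub_distrib]
  congr 1
  · conv_rhs => rw [cov_eq_sum (fderiv ℝ φ p X)]
    simp
  · conv_rhs => rw [cov_eq_sum (fderiv ℝ φ p Y)]
    simp

lemma contract_d {φ : E7 → Cov} {p : E7} (h : DifferentiableAt ℝ φ p) (X : E7) :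
    ∃ η : Cov, contract X (d φ p) = toExt η ∧ ∀ Y, η Y = extD φ p X Y := by
  refine ⟨∑ i : Fin 7, (fderiv ℝ (fun x => φ x (Pi.single i 1)) p X •
      (ContinuousLinearMap.proj i : Cov) - (ContinuousLinearMap.proj i : Cov) X •
      fderiv ℝ (fun x => φ x (Pi.single i 1)) p), ?_, fun Y => ?_⟩
  · simp only [d, contract, map_sum]
    refine Finset.sum_congr rfl fun i _ => ?_
    exact contract_toExt_mul X _ _
  · rw [← ev2_d h]
    simp [d, ev2_mul, wdg, mul_comm]

/-- The bridge from congruences in the exterior algebra to values on pairs of vectors; the structure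
equations are handled only in the latter form. -/
lemma modEq_d_iff {I : Submodule ℝ Cov} {φ : E7 → Cov} {p : E7} (h : DifferentiableAt ℝ φ p)
    {Ω : Ext} (hΩ : Ω ∈ twoForms) :
    ModEq I (d φ p) Ω ↔ ∀ X Y : E7, (∀ ξ ∈ I, ξ X = 0) → (∀ ξ ∈ I, ξ Y = 0) →
      extD φ p X Y = ev2 X Y Ω := by
  rw [modEq_iff (d_mem_twoForms φ p) hΩ]
  simp only [ev2_d h]

/-- Two forms proportional modulo `I` to a decomposable form have zero product modulo `I`. -/
lemma mul_mem_extIdeal {I : Submodule ℝ Cov} {Ω Ω' : Ext} {α β : Cov} {c c' : ℝ}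
    (h : ModEq I Ω (c • (toExt α * toExt β))) (h' : ModEq I Ω' (c' • (toExt α * toExt β))) :
    Ω * Ω' ∈ extIdeal I := by
  have e : Ω * Ω' = (Ω - c • (toExt α * toExt β)) * Ω' +
      (c • (toExt α * toExt β)) * (Ω' - c' • (toExt α * toExt β)) +
      (c * c') • ((toExt α * toExt β) * (toExt α * toExt β)) := by
    simp only [sub_mul, mul_sub, smul_mul_assoc, mul_smul_comm, smul_smul, mul_comm c' c]; abel
  have z : (toExt α * toExt β) * (toExt α * toExt β) = 0 := by
    have : (toExt α * toExt β) * (toExt α * toExt β) =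
        toExt α * (toExt β * toExt α) * toExt β := by simp only [mul_assoc]
    rw [this, toExt_mul_swap β α, mul_neg, ← mul_assoc, ExteriorAlgebra.ι_sq_zero]
    simp
  rw [e, z, smul_zero, add_zero]
  exact add_mem (extIdeal_mul_right _ _ h) (Ideal.mul_mem_left _ _ h')

/-- Each generator of the ideal is a combination of a, b, c and repeats a factor of a∧b∧c. This
turns a product lying in the ideal of I_F into orthogonality for the bilinear form. -/
lemma mul_eq_zero_of_mem {a b c : Cov} {w : Ext}
    (h : w ∈ extIdeal (Submodule.span ℝ {a, b, c})) :
    w * toExt a * toExt b * toExt c = 0 := by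
  have hp : ∀ ξ ∈ Submodule.span ℝ {a, b, c}, toExt ξ * toExt a * toExt b * toExt c = 0 := by
    intro ξ hξ
    rw [Submodule.mem_span_triple] at hξ
    obtain ⟨x, y, z, rfl⟩ := hξ
    have ha : toExt a * toExt a = 0 := ExteriorAlgebra.ι_sq_zero a
    have hb : toExt b * toExt b = 0 := ExteriorAlgebra.ι_sq_zero b
    have hc : toExt c * toExt c = 0 := ExteriorAlgebra.ι_sq_zero c
    have h1 : toExt b * toExt a * toExt b * toExt c = 0 := by
      rw [toExt_mul_swap b a, neg_mul, mul_assoc (toExt a), hb]; simp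
    have h2 : toExt c * toExt a * toExt b * toExt c = 0 := by
      rw [mul_assoc (toExt c * toExt a), toExt_mul_swap b c, toExt_mul_swap c a, mul_neg, neg_mul,
        neg_neg, mul_assoc, ← mul_assoc (toExt c), hc]; simp
    have h0 : toExt a * toExt a * toExt b * toExt c = 0 := by rw [ha]; simp
    have : toExt (x • a + y • b + z • c) = x • toExt a + y • toExt b + z • toExt c := by
      simp [toExt]
    rw [this]
    simp only [add_mul, smul_mul_assoc, h0, h1, h2, smul_zero, add_zero]
  induction h using Submodule.span_induction with
  | mem x hx => obtain ⟨ξ, hξ, rfl⟩ := hx; exact hp ξ hξ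
  | zero => simp
  | add x y _ _ hx hy => simp only [add_mul, hx, hy, add_zero]
  | smul r x _ hx => simp only [smul_eq_mul, mul_assoc] at hx ⊢; rw [hx, mul_zero]

/-! ### Differentials on pairs of vectors -/

lemma extD_congr {φ ψ : E7 → Cov} {p : E7} (h : φ =ᶠ[𝓝 p] ψ) (X Y : E7) :
    extD φ p X Y = extD ψ p X Y := by
  simp only [extD, h.fderiv_eq]

lemma extD_add {φ ψ : E7 → Cov} {p : E7} (hφ : DifferentiableAt ℝ φ p)
    (hψ : DifferentiableAt ℝ ψ p) (X Y : E7) :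
    extD (fun x => φ x + ψ x) p X Y = extD φ p X Y + extD ψ p X Y := by
  simp only [extD, fderiv_fun_add hφ hψ, add_apply]; ring

lemma extD_smul {f : E7 → ℝ} {φ : E7 → Cov} {p : E7} (hf : DifferentiableAt ℝ f p)
    (hφ : DifferentiableAt ℝ φ p) (X Y : E7) :
    extD (fun x => f x • φ x) p X Y = f p * extD φ p X Y + wdg (fderiv ℝ f p) (φ p) X Y := by
  simp only [extD, wdg, fderiv_fun_smul hf hφ, add_apply,
    smul_apply, ContinuousLinearMap.smulRight_apply, smul_eq_mul]
  ring

lemma extD_sum {ι : Type*} (s : Finset ι) {φ : ι → E7 → Cov} {p : E7}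
    (h : ∀ i ∈ s, DifferentiableAt ℝ (φ i) p) (X Y : E7) :
    extD (fun x => ∑ i ∈ s, φ i x) p X Y = ∑ i ∈ s, extD (φ i) p X Y := by
  simp only [extD, fderiv_fun_sum h, sum_apply, Finset.sum_sub_distrib]

/-! ### Coframes and dual frames -/

/-- A smooth coframe on an open set. -/
structure IsCoframe (V : Set E7) (om : Fin 7 → E7 → Cov) : Prop where
  isOpen : IsOpen V
  smooth : ∀ i, ContDiffOn ℝ ∞ (om i) V
  linInd : ∀ p ∈ V, LinearIndependent ℝ fun i => om i p

/-- The components of tangent vectors with respect to a coframe. -/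
def frameMap (om : Fin 7 → E7 → Cov) (x : E7) : E7 →L[ℝ] (Fin 7 → ℝ) :=
  ContinuousLinearMap.pi fun i => om i x

/-- The frame dual to a coframe. -/
def dualFrame (om : Fin 7 → E7 → Cov) (i : Fin 7) (x : E7) : E7 :=
  (frameMap om x).inverse (Pi.single i 1)

lemma finrank_cov : Module.finrank ℝ Cov = 7 := by
  have e : Cov ≃ₗ[ℝ] Module.Dual ℝ E7 := LinearMap.toContinuousLinearMap.symm
  rw [e.finrank_eq, Subspace.dual_finrank_eq]; simp

/-- Seven covectors are independent if and only if they have no common kernel. -/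
lemma linearIndependent_iff_ker {a : Fin 7 → Cov} :
    LinearIndependent ℝ a ↔ ∀ X, (∀ i, a i X = 0) → X = 0 := by
  let L : E7 →ₗ[ℝ] (Fin 7 → ℝ) := LinearMap.pi fun i => (a i : E7 →ₗ[ℝ] ℝ)
  constructor
  · intro h X hX
    have hs : Submodule.span ℝ (Set.range a) = ⊤ :=
      h.span_eq_top_of_card_eq_finrank (by rw [finrank_cov]; simp)
    have : ∀ ξ : Cov, ξ X = 0 := by
      intro ξ
      have hξ : ξ ∈ Submodule.span ℝ (Set.range a) := by rw [hs]; trivial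
      induction hξ using Submodule.span_induction with
      | mem x hx => obtain ⟨i, rfl⟩ := hx; exact hX i
      | zero => rfl
      | add x y _ _ hx hy => simp [hx, hy]
      | smul c x _ hx => simp [hx]
    ext i
    exact this (ContinuousLinearMap.proj i)
  · intro h
    have hinj : Function.Injective L := by
      rw [← LinearMap.ker_eq_bot, LinearMap.ker_eq_bot']
      intro X hX
      exact h X fun i => congrFun hX i
    have hsurj : Function.Surjective L := LinearMap.injective_iff_surjective.1 hinj
    rw [Fintype.linearIndependent_iff]
    intro g hg i
    obtain ⟨X, hX⟩ := hsurj (Pi.single i 1)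
    have h1 := congrArg (fun ξ : Cov => ξ X) hg
    have h2 : ∀ j, a j X = (Pi.single i 1 : Fin 7 → ℝ) j := fun j => congrFun hX j
    simpa [h2, Pi.single_apply] using h1

lemma frameMap_isInvertible {om : Fin 7 → E7 → Cov} {x : E7}
    (h : LinearIndependent ℝ fun i => om i x) : (frameMap om x).IsInvertible := by
  have hinj : Function.Injective (frameMap om x : E7 →ₗ[ℝ] (Fin 7 → ℝ)) := by
    rw [← LinearMap.ker_eq_bot, LinearMap.ker_eq_bot']
    intro X hX
    exact linearIndependent_iff_ker.1 h X fun i => congrFun hX i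
  refine ⟨(LinearEquiv.ofBijective _ ⟨hinj,
    LinearMap.injective_iff_surjective.1 hinj⟩).toContinuousLinearEquiv, ?_⟩
  ext; rfl

namespace IsCoframe

variable {V : Set E7} {om : Fin 7 → E7 → Cov} (H : IsCoframe V om)
include H

lemma mono {V' : Set E7} (hV : IsOpen V') (h : V' ⊆ V) : IsCoframe V' om :=
  ⟨hV, fun i => (H.smooth i).mono h, fun p hp => H.linInd p (h hp)⟩

lemma apply_dualFrame {x : E7} (hx : x ∈ V) (i j : Fin 7) :
    om j x (dualFrame om i x) = if j = i then 1 else 0 := by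
  obtain ⟨e, he⟩ := frameMap_isInvertible (H.linInd x hx)
  have h1 : frameMap om x (dualFrame om i x) = Pi.single i 1 := by
    rw [dualFrame, ← he, ContinuousLinearMap.inverse_equiv]; simp
  have h2 : om j x (dualFrame om i x) = (Pi.single i 1 : Fin 7 → ℝ) j := congrFun h1 j
  rw [h2, Pi.single_apply]

lemma smooth_dualFrame (i : Fin 7) : ContDiffOn ℝ ∞ (dualFrame om i) V := by
  intro x hx
  have h1 : ContDiffWithinAt ℝ ∞ (frameMap om) V x :=
    contDiffOn_clm_apply.2 (fun Y => contDiffOn_pi.2 fun i =>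
      (H.smooth i).clm_apply contDiffOn_const) x hx
  have h2 := (frameMap_isInvertible (H.linInd x hx)).contDiffAt_map_inverse (n := ∞)
  exact (h2.comp_contDiffWithinAt x h1).clm_apply contDiffWithinAt_const

lemma vec_ext {x : E7} (hx : x ∈ V) {X Y : E7} (h : ∀ i, om i x X = om i x Y) : X = Y := by
  rw [← sub_eq_zero]
  exact linearIndependent_iff_ker.1 (H.linInd x hx) _ fun i => by rw [map_sub, h, sub_self]

lemma vec_eq_sum {x : E7} (hx : x ∈ V) (X : E7) :
    X = ∑ i, om i x X • dualFrame om i x := by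
  refine H.vec_ext hx fun j => ?_
  simp [H.apply_dualFrame hx]

lemma cov_eq_sum {x : E7} (hx : x ∈ V) (ξ : Cov) :
    ξ = ∑ i, ξ (dualFrame om i x) • om i x := by
  ext X
  conv_lhs => rw [H.vec_eq_sum hx X]
  simp [mul_comm]

lemma differentiableAt (i : Fin 7) {p : E7} (hp : p ∈ V) : DifferentiableAt ℝ (om i) p :=
  ((H.smooth i).contDiffAt (H.isOpen.mem_nhds hp)).differentiableAt (by simp)

/-- Expansion of a 1-form and of its differential in a coframe. -/
lemma expand {p : E7} (hp : p ∈ V) {U : Set E7} {φ : E7 → Cov} (hU : IsOpen U) (hpU : p ∈ U)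
    (hφ : ContDiffOn ℝ ∞ φ U) (s : Finset (Fin 7))
    (hs : ∀ x ∈ U, x ∈ V → ∀ i ∉ s, φ x (dualFrame om i x) = 0) :
    ∃ dc : Fin 7 → Cov, φ p = ∑ i ∈ s, φ p (dualFrame om i p) • om i p ∧
      ∀ X Y, extD φ p X Y = ∑ i ∈ s, (φ p (dualFrame om i p) * extD (om i) p X Y +
        wdg (dc i) (om i p) X Y) := by
  have hsum : ∀ x ∈ U, x ∈ V → φ x = ∑ i ∈ s, φ x (dualFrame om i x) • om i x := by
    intro x hxU hxV
    conv_lhs => rw [H.cov_eq_sum hxV (φ x)]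
    refine (Finset.sum_subset (Finset.subset_univ s) fun i _ hi => ?_).symm
    rw [hs x hxU hxV i hi, zero_smul]
  have hc : ∀ i, DifferentiableAt ℝ (fun x => φ x (dualFrame om i x)) p := by
    intro i
    have h1 := (hφ.contDiffAt (hU.mem_nhds hpU)).differentiableAt (by simp)
    have h2 := ((H.smooth_dualFrame i).contDiffAt (H.isOpen.mem_nhds hp)).differentiableAt
      (by simp)
    exact h1.clm_apply h2
  refine ⟨fun i => fderiv ℝ (fun x => φ x (dualFrame om i x)) p, hsum p hpU hp, fun X Y => ?_⟩
  -- The omitted coefficients vanish on a whole neighbourhood, not only at p, so their differentials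
  -- drop out as well.
  have hev : φ =ᶠ[𝓝 p] fun x => ∑ i ∈ s, φ x (dualFrame om i x) • om i x := by
    filter_upwards [hU.mem_nhds hpU, H.isOpen.mem_nhds hp] with x h1 h2 using hsum x h1 h2
  rw [extD_congr hev, extD_sum s fun i _ => (hc i).fun_smul (H.differentiableAt i hp)]
  refine Finset.sum_congr rfl fun i _ => ?_
  rw [extD_smul (hc i) (H.differentiableAt i hp)]

end IsCoframe

/-! ### Structure equations evaluated on vectors, and recovery of the adapted coframe conditions -/

lemma mem_span_pair_apply {a b ξ : Cov} (h : ξ ∈ Submodule.span ℝ {a, b}) {X : E7}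
    (ha : a X = 0) (hb : b X = 0) : ξ X = 0 := by
  obtain ⟨x, y, rfl⟩ := Submodule.mem_span_pair.1 h
  simp [ha, hb]

lemma mem_span_triple_apply {a b c ξ : Cov} (h : ξ ∈ Submodule.span ℝ {a, b, c}) {X : E7}
    (ha : a X = 0) (hb : b X = 0) (hc : c X = 0) : ξ X = 0 := by
  obtain ⟨x, y, z, rfl⟩ := Submodule.mem_span_triple.1 h
  simp [ha, hb, hc]

/-- A smooth coframe whose first three forms span the contact system and which satisfies the
structure equations, evaluated on vectors. -/
structure IsWeakCoframe (iF : E7 → J2) (V : Set E7) (om : Fin 7 → E7 → Cov) (ε : ℝ) : Prop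
    extends IsCoframe V om where
  sign : ε = 1 ∨ ε = -1
  contact : ∀ p ∈ V, contactSystem iF p = Submodule.span ℝ {om 0 p, om 1 p, om 2 p}
  eq₁ : ∀ p ∈ V, ∀ X Y, om 0 p X = 0 → om 0 p Y = 0 → extD (om 0) p X Y =
    wdg (om 2 p) (om 5 p) X Y + wdg (om 1 p) (om 3 p) X Y
  eq₂ : ∀ p ∈ V, ∀ X Y, om 0 p X = 0 → om 0 p Y = 0 → om 1 p X = 0 → om 1 p Y = 0 →
    extD (om 1) p X Y = wdg (om 3 p) (om 4 p) X Y + wdg (om 2 p) (om 6 p) X Y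
  eq₃ : ∀ p ∈ V, ∀ X Y, om 0 p X = 0 → om 0 p Y = 0 → om 2 p X = 0 → om 2 p Y = 0 →
    extD (om 2) p X Y = wdg (om 5 p) (om 6 p) X Y + ε * wdg (om 1 p) (om 4 p) X Y

/-- The conditions on the derived and characteristic systems are dropped because they follow from
the structure equations, see `IsWeakCoframe.isAdaptedCoframe`. -/
lemma IsAdaptedCoframe.isWeakCoframe {iF : E7 → J2} {V : Set E7} {om : Fin 7 → E7 → Cov} {ε : ℝ}
    (H : IsAdaptedCoframe iF V om ε) : IsWeakCoframe iF V om ε := by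
  have C : IsCoframe V om := ⟨H.isOpen, H.smooth, H.linInd⟩
  refine ⟨C, H.sign, H.contact, ?_, ?_, ?_⟩
  · intro p hp X Y hX hY
    have := (modEq_d_iff (C.differentiableAt 0 hp) (add_mem (mul_mem_twoForms _ _)
      (mul_mem_twoForms _ _))).1 (H.streq₁ p hp) X Y
    simp only [map_add, ev2_mul, Submodule.mem_span_singleton] at this
    exact this (by rintro _ ⟨c, rfl⟩; simp [hX]) (by rintro _ ⟨c, rfl⟩; simp [hY])
  · intro p hp X Y hX hY hX' hY'
    have := (modEq_d_iff (C.differentiableAt 1 hp) (add_mem (mul_mem_twoForms _ _)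
      (mul_mem_twoForms _ _))).1 (H.streq₂ p hp) X Y
    simp only [map_add, ev2_mul] at this
    exact this (fun ξ h => mem_span_pair_apply h hX hX') (fun ξ h => mem_span_pair_apply h hY hY')
  · intro p hp X Y hX hY hX' hY'
    have := (modEq_d_iff (C.differentiableAt 2 hp) (add_mem (mul_mem_twoForms _ _)
      (twoForms.smul_mem _ (mul_mem_twoForms _ _)))).1 (H.streq₃ p hp) X Y
    simp only [map_add, map_smul, ev2_mul, smul_eq_mul] at this
    exact this (fun ξ h => mem_span_pair_apply h hX hX') (fun ξ h => mem_span_pair_apply h hY hY')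

/-- Expansion of the sections of a system spanned by the first three forms of a coframe. -/
lemma IsCoframe.expand_contact {V : Set E7} {om : Fin 7 → E7 → Cov} (C : IsCoframe V om)
    {I : Pfaffian} (hI : ∀ p ∈ V, I p = Submodule.span ℝ {om 0 p, om 1 p, om 2 p})
    {p : E7} (hp : p ∈ V) {U : Set E7} {φ : E7 → Cov} (hpU : p ∈ U) (hφ : IsSection I U φ) :
    ∃ (c : Fin 3 → ℝ) (dc : Fin 3 → Cov), φ p = c 0 • om 0 p + c 1 • om 1 p + c 2 • om 2 p ∧
      ∀ X Y, extD φ p X Y = (c 0 * extD (om 0) p X Y + wdg (dc 0) (om 0 p) X Y) +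
        (c 1 * extD (om 1) p X Y + wdg (dc 1) (om 1 p) X Y) +
        (c 2 * extD (om 2) p X Y + wdg (dc 2) (om 2 p) X Y) := by
  obtain ⟨dc, h1, h2⟩ := C.expand hp hφ.isOpen hpU hφ.smooth {0, 1, 2} (by
    intro x hxU hxV i hi
    have h := hφ.mem x hxU
    rw [hI x hxV] at h
    simp only [Finset.mem_insert, Finset.mem_singleton, not_or] at hi
    refine mem_span_triple_apply h ?_ ?_ ?_ <;> rw [C.apply_dualFrame hxV, if_neg] <;>
      tauto)
  refine ⟨fun k => φ p (dualFrame om (Fin.castLE (by norm_num) k) p),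
    fun k => dc (Fin.castLE (by norm_num) k), ?_, fun X Y => ?_⟩
  · rw [Finset.sum_insert (by decide), Finset.sum_insert (by decide), Finset.sum_singleton,
      ← add_assoc] at h1
    exact h1
  · rw [h2, Finset.sum_insert (by decide), Finset.sum_insert (by decide), Finset.sum_singleton,
      ← add_assoc]
    rfl

lemma contactSystem_eq (iF : E7 → J2) (p : E7) : contactSystem iF p =
    Submodule.span ℝ {contactForm iF 0 p, contactForm iF 1 p, contactForm iF 2 p} := by
  rw [contactSystem]
  congr 1
  ext ξ
  simp only [Set.mem_range, Fin.exists_fin_succ, Set.mem_insert_iff, Set.mem_singleton_iff]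
  simp [eq_comm]

/-- If `dω¹ ≡ 0` and `dω²` is decomposable modulo the contact system, then `{ω¹, ω²}` is
isotropic. -/
lemma IsCoframe.isCharSystem {iF : E7 → J2} {V : Set E7} {om : Fin 7 → E7 → Cov}
    (C : IsCoframe V om)
    (hI : ∀ p ∈ V, contactSystem iF p = Submodule.span ℝ {om 0 p, om 1 p, om 2 p})
    (h₀ : ∀ p ∈ V, ∀ X Y, (∀ ξ ∈ contactSystem iF p, ξ X = 0) →
      (∀ ξ ∈ contactSystem iF p, ξ Y = 0) → extD (om 0) p X Y = 0)
    (α β : E7 → Cov)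
    (h₁ : ∀ p ∈ V, ∀ X Y, (∀ ξ ∈ contactSystem iF p, ξ X = 0) →
      (∀ ξ ∈ contactSystem iF p, ξ Y = 0) → extD (om 1) p X Y = wdg (α p) (β p) X Y) :
    IsCharSystem iF V fun p => Submodule.span ℝ {om 0 p, om 1 p} := by
  refine ⟨C.isOpen, ⟨om 0, om 1, C.smooth 0, C.smooth 1, fun p _ => rfl⟩, ?_, ?_, ?_⟩
  · intro p hp
    rw [hI p hp]
    exact Submodule.span_mono (by intro x; simp; tauto)
  · intro p hp
    have hl : LinearIndependent ℝ ![om 0 p, om 1 p] := by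
      have := (C.linInd p hp).comp (![0, 1] : Fin 2 → Fin 7) (by
        intro i j; fin_cases i <;> fin_cases j <;> simp)
      convert this using 1
      ext i; fin_cases i <;> rfl
    have := finrank_span_eq_card hl
    rwa [Matrix.range_cons_cons_empty, Fintype.card_fin] at this
  · intro p hp U φ ψ hpU hφ hψ hφM hψM
    -- A section of I_F whose value at p lies in {ω¹, ω²} may leave that span nearby, but its
    -- ω³-coefficient vanishes at p and the differentials of the coefficients only enter wedged with
    -- forms of I_F. Hence its differential is a multiple of the single decomposable form α∧β.
    have key : ∀ χ, IsSection (contactSystem iF) U χ →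
        χ p ∈ Submodule.span ℝ {om 0 p, om 1 p} →
        ∃ c : ℝ, ModEq (contactSystem iF p) (d χ p) (c • (toExt (α p) * toExt (β p))) := by
      intro χ hχ hχM
      obtain ⟨c, dc, e1, e2⟩ := C.expand_contact hI hp hpU hχ
      refine ⟨c 1, ?_⟩
      have hd : DifferentiableAt ℝ χ p :=
        (hχ.smooth.contDiffAt (hχ.isOpen.mem_nhds hpU)).differentiableAt (by simp)
      rw [modEq_d_iff hd (twoForms.smul_mem _ (mul_mem_twoForms _ _))]
      intro X Y hX hY
      have c2 : c 2 = 0 := by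
        have h3 := mem_span_pair_apply hχM (X := dualFrame om 2 p)
          (by simp [C.apply_dualFrame hp]) (by simp [C.apply_dualFrame hp])
        rw [e1] at h3
        simpa [C.apply_dualFrame hp] using h3
      have hm : ∀ k : Fin 7, k ∈ ({0, 1, 2} : Finset (Fin 7)) → om k p ∈ contactSystem iF p := by
        intro k hk
        rw [hI p hp]
        refine Submodule.subset_span ?_
        simp only [Finset.mem_insert, Finset.mem_singleton] at hk
        rcases hk with rfl | rfl | rfl <;> simp
      rw [e2, h₀ p hp X Y hX hY, h₁ p hp X Y hX hY, c2, map_smul, ev2_mul]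
      simp only [wdg, hX _ (hm 0 (by simp)), hX _ (hm 1 (by simp)), hX _ (hm 2 (by simp)),
        hY _ (hm 0 (by simp)), hY _ (hm 1 (by simp)), hY _ (hm 2 (by simp)), smul_eq_mul]
      ring
    obtain ⟨c, hc⟩ := key φ hφ hφM
    obtain ⟨c', hc'⟩ := key ψ hψ hψM
    have := mul_mem_extIdeal hc hc'
    rw [contactSystem_eq] at this
    exact mul_eq_zero_of_mem this

/-- The coframe with `ω²` and `ω³` exchanged, adapted to the opposite labelling of the
characteristic systems. -/
def swapCoframe (ε : ℝ) (om : Fin 7 → E7 → Cov) : Fin 7 → E7 → Cov :=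
  ![fun x => ε • om 0 x, om 2, om 1, fun x => ε • om 5 x, fun x => ε • om 6 x,
    fun x => ε • om 3 x, fun x => ε • om 4 x]

lemma IsCoframe.swap {V : Set E7} {om : Fin 7 → E7 → Cov} (H : IsCoframe V om) {ε : ℝ}
    (hne : ε ≠ 0) : IsCoframe V (swapCoframe ε om) := by
  refine ⟨H.isOpen, ?_, ?_⟩
  · intro i
    have := H.smooth
    fin_cases i <;> simp only [swapCoframe] <;>
      first | exact (this _).const_smul ε | exact this _
  · intro p hp
    rw [linearIndependent_iff_ker]
    intro X hX
    refine linearIndependent_iff_ker.1 (H.linInd p hp) X fun i => ?_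
    have h0 := hX 0
    have h1 := hX 1
    have h2 := hX 2
    have h3 := hX 3
    have h4 := hX 4
    have h5 := hX 5
    have h6 := hX 6
    simp [swapCoframe, hne] at h0 h1 h2 h3 h4 h5 h6
    fin_cases i <;> simp [*]

lemma span_swapCoframe {ε : ℝ} (hne : ε ≠ 0) (om : Fin 7 → E7 → Cov) (p : E7) :
    Submodule.span ℝ {swapCoframe ε om 0 p, swapCoframe ε om 1 p, swapCoframe ε om 2 p} =
      Submodule.span ℝ {om 0 p, om 1 p, om 2 p} := by
  simp only [swapCoframe, Matrix.cons_val]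
  rw [Set.pair_comm (om 2 p), Submodule.span_insert, Submodule.span_insert (om 0 p),
    Submodule.span_singleton_smul_eq (IsUnit.mk0 ε hne)]

namespace IsWeakCoframe

variable {iF : E7 → J2} {V : Set E7} {om : Fin 7 → E7 → Cov} {ε : ℝ}
  (H : IsWeakCoframe iF V om ε)
include H

lemma mono {V' : Set E7} (hV : IsOpen V') (h : V' ⊆ V) : IsWeakCoframe iF V' om ε :=
  ⟨H.toIsCoframe.mono hV h, H.sign, fun p hp => H.contact p (h hp), fun p hp => H.eq₁ p (h hp),
    fun p hp => H.eq₂ p (h hp), fun p hp => H.eq₃ p (h hp)⟩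

lemma sq_sign : ε * ε = 1 := by rcases H.sign with rfl | rfl <;> norm_num

/-- The factors ε in `swapCoframe` move the sign from the third equation of the old labelling to the
third of the new one, using ε² = 1. Hence the sign does not depend on which characteristic system is
called M₁. -/
lemma swap : IsWeakCoframe iF V (swapCoframe ε om) ε := by
  have hne : ε ≠ 0 := by rcases H.sign with rfl | rfl <;> norm_num
  have hsq := H.sq_sign
  refine ⟨H.toIsCoframe.swap hne, H.sign, ?_, ?_, ?_, ?_⟩
  · intro p hp
    rw [H.contact p hp, span_swapCoframe hne]
  · intro p hp X Y hX hY
    simp only [swapCoframe, Matrix.cons_val] at hX hY ⊢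
    have hX' : om 0 p X = 0 := by simpa [hne] using hX
    have hY' : om 0 p Y = 0 := by simpa [hne] using hY
    have := H.eq₁ p hp X Y hX' hY'
    rw [extD_smul (differentiableAt_const _) (H.differentiableAt 0 hp), this]
    simp [wdg, hX', hY']
    ring
  · intro p hp X Y hX hY hX' hY'
    simp only [swapCoframe, Matrix.cons_val] at hX hY hX' hY' ⊢
    rw [H.eq₃ p hp X Y (by simpa [hne] using hX) (by simpa [hne] using hY) hX' hY']
    simp [wdg]
    linear_combination (om 5 p X * om 6 p Y - om 5 p Y * om 6 p X) * (-hsq)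
  · intro p hp X Y hX hY hX' hY'
    simp only [swapCoframe, Matrix.cons_val] at hX hY hX' hY' ⊢
    rw [H.eq₂ p hp X Y (by simpa [hne] using hX) (by simpa [hne] using hY) hX' hY']
    simp [wdg]
    linear_combination (om 3 p X * om 4 p Y - om 3 p Y * om 4 p X +
      om 2 p X * om 6 p Y - om 2 p Y * om 6 p X) * (-hsq)

lemma mem_contact {p : E7} (hp : p ∈ V) {k : Fin 7} (hk : k = 0 ∨ k = 1 ∨ k = 2) :
    om k p ∈ contactSystem iF p := by
  rw [H.contact p hp]
  refine Submodule.subset_span ?_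
  rcases hk with rfl | rfl | rfl <;> simp

lemma isCharSystem₁ : IsCharSystem iF V fun p => Submodule.span ℝ {om 0 p, om 1 p} := by
  refine H.isCharSystem H.contact ?_ (om 3) (om 4) ?_
  · intro p hp X Y hX hY
    have h := fun k hk => hX _ (H.mem_contact hp (k := k) hk)
    have h' := fun k hk => hY _ (H.mem_contact hp (k := k) hk)
    rw [H.eq₁ p hp X Y (h 0 (by simp)) (h' 0 (by simp))]
    simp [wdg, h 1, h 2, h' 1, h' 2]
  · intro p hp X Y hX hY
    have h := fun k hk => hX _ (H.mem_contact hp (k := k) hk)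
    have h' := fun k hk => hY _ (H.mem_contact hp (k := k) hk)
    rw [H.eq₂ p hp X Y (h 0 (by simp)) (h' 0 (by simp)) (h 1 (by simp)) (h' 1 (by simp))]
    simp [wdg, h 2, h' 2]

lemma isCharSystem₂ : IsCharSystem iF V fun p => Submodule.span ℝ {om 0 p, om 2 p} := by
  have := H.swap.isCharSystem₁
  have hne : ε ≠ 0 := by rcases H.sign with rfl | rfl <;> norm_num
  simp only [swapCoframe, Matrix.cons_val] at this
  convert this using 2 with p
  rw [Submodule.span_insert, Submodule.span_insert (ε • om 0 p),
    Submodule.span_singleton_smul_eq (IsUnit.mk0 ε hne)]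

/-- Modulo I_F, a section c₀ω¹ + c₁ω² + c₂ω³ has differential c₁ ω⁴∧ω⁵ + c₂ ω⁶∧ω⁷, and these two
forms are independent. -/
lemma derived {p : E7} (hp : p ∈ V) :
    derivedAt (contactSystem iF) p = (Submodule.span ℝ {om 0 p} : Set Cov) := by
  ext ξ
  constructor
  · rintro ⟨U, φ, hpU, hφ, hd, rfl⟩
    obtain ⟨c, dc, e1, e2⟩ := H.expand_contact H.contact hp hpU hφ
    have hdiff : DifferentiableAt ℝ φ p :=
      (hφ.smooth.contDiffAt (hφ.isOpen.mem_nhds hpU)).differentiableAt (by simp)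
    have h := (modEq_d_iff hdiff (zero_mem twoForms)).1 (hd p hpU)
    have hperp : ∀ k : Fin 7, 3 ≤ k → ∀ ξ ∈ contactSystem iF p, ξ (dualFrame om k p) = 0 := by
      intro k hk ξ hξ
      rw [H.contact p hp] at hξ
      refine mem_span_triple_apply hξ ?_ ?_ ?_ <;> rw [H.apply_dualFrame hp, if_neg] <;>
        (rintro rfl; revert hk; decide)
    have v := fun i j => H.apply_dualFrame hp i j
    have c1 : c 1 = 0 := by
      have := h (dualFrame om 3 p) (dualFrame om 4 p) (hperp 3 (by decide)) (hperp 4 (by decide))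
      rw [e2, H.eq₁ p hp _ _ (by simp [v]) (by simp [v]),
        H.eq₂ p hp _ _ (by simp [v]) (by simp [v]) (by simp [v]) (by simp [v]),
        H.eq₃ p hp _ _ (by simp [v]) (by simp [v]) (by simp [v]) (by simp [v])] at this
      simpa [wdg, v] using this
    have c2 : c 2 = 0 := by
      have := h (dualFrame om 5 p) (dualFrame om 6 p) (hperp 5 (by decide)) (hperp 6 (by decide))
      rw [e2, H.eq₁ p hp _ _ (by simp [v]) (by simp [v]),
        H.eq₂ p hp _ _ (by simp [v]) (by simp [v]) (by simp [v]) (by simp [v]),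
        H.eq₃ p hp _ _ (by simp [v]) (by simp [v]) (by simp [v]) (by simp [v])] at this
      simpa [wdg, v] using this
    rw [e1, c1, c2]
    simp only [zero_smul, add_zero]
    exact Submodule.smul_mem _ _ (Submodule.mem_span_singleton_self _)
  · intro hξ
    obtain ⟨c, rfl⟩ := Submodule.mem_span_singleton.1 hξ
    refine ⟨V, fun x => c • om 0 x, hp, ⟨H.isOpen, (H.smooth 0).const_smul c, fun x hx =>
      Submodule.smul_mem _ _ (H.mem_contact hx (by simp))⟩, fun x hx => ?_, rfl⟩
    rw [modEq_d_iff ((H.differentiableAt 0 hx).fun_const_smul c) (zero_mem _)]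
    intro X Y hX hY
    have h := fun k hk => hX _ (H.mem_contact hx (k := k) hk)
    have h' := fun k hk => hY _ (H.mem_contact hx (k := k) hk)
    rw [extD_smul (differentiableAt_const _) (H.differentiableAt 0 hx),
      H.eq₁ x hx X Y (h 0 (by simp)) (h' 0 (by simp))]
    simp [wdg, h 0, h 1, h 2, h' 0, h' 1, h' 2]

lemma isAdaptedCoframe : IsAdaptedCoframe iF V om ε := by
  refine ⟨H.isOpen, H.smooth, H.linInd, H.sign, H.contact, fun p hp => H.derived hp,
    H.isCharSystem₁, H.isCharSystem₂, ?_, ?_, ?_⟩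
  · intro p hp
    rw [modEq_d_iff (H.differentiableAt 0 hp) (add_mem (mul_mem_twoForms _ _)
      (mul_mem_twoForms _ _))]
    intro X Y hX hY
    rw [H.eq₁ p hp X Y (hX _ (Submodule.subset_span (by simp)))
      (hY _ (Submodule.subset_span (by simp))), map_add, ev2_mul, ev2_mul]
  · intro p hp
    rw [modEq_d_iff (H.differentiableAt 1 hp) (add_mem (mul_mem_twoForms _ _)
      (mul_mem_twoForms _ _))]
    intro X Y hX hY
    rw [H.eq₂ p hp X Y (hX _ (Submodule.subset_span (by simp)))
      (hY _ (Submodule.subset_span (by simp))) (hX _ (Submodule.subset_span (by simp)))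
      (hY _ (Submodule.subset_span (by simp))), map_add, ev2_mul, ev2_mul]
  · intro p hp
    rw [modEq_d_iff (H.differentiableAt 2 hp) (add_mem (mul_mem_twoForms _ _)
      (twoForms.smul_mem _ (mul_mem_twoForms _ _)))]
    intro X Y hX hY
    rw [H.eq₃ p hp X Y (hX _ (Submodule.subset_span (by simp)))
      (hY _ (Submodule.subset_span (by simp))) (hX _ (Submodule.subset_span (by simp)))
      (hY _ (Submodule.subset_span (by simp))), map_add, map_smul, ev2_mul, ev2_mul, smul_eq_mul]

end IsWeakCoframe

/-! ### Uniqueness of the sign -/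

namespace IsWeakCoframe

variable {iF : E7 → J2} {ε ε' : ℝ} {V : Set E7} {om om' : Fin 7 → E7 → Cov}

/-- The components of the contact forms of one coframe in terms of another one: the derived
system is preserved, and the characteristic systems are preserved or exchanged. -/
lemma transition (H : IsWeakCoframe iF V om ε) (H' : IsWeakCoframe iF V om' ε') {x : E7}
    (hx : x ∈ V) :
    (om' 0 x (dualFrame om 1 x) = 0 ∧ om' 0 x (dualFrame om 2 x) = 0) ∧
    (om' 1 x (dualFrame om 1 x) * om' 1 x (dualFrame om 2 x) = 0 ∧
      om' 2 x (dualFrame om 1 x) * om' 2 x (dualFrame om 2 x) = 0) := by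
  have v := fun i j => H.apply_dualFrame hx i j
  have hsec : ∀ k : Fin 7, k = 0 ∨ k = 1 ∨ k = 2 → IsSection (contactSystem iF) V (om' k) :=
    fun k hk => ⟨H'.isOpen, H'.smooth k, fun y hy => H'.mem_contact hy hk⟩
  have hperp : ∀ i : Fin 7, 3 ≤ i → ∀ k : Fin 7, k = 0 ∨ k = 1 ∨ k = 2 →
      om' k x (dualFrame om i x) = 0 := by
    intro i hi k hk
    have hm := H'.mem_contact hx hk
    rw [H.contact x hx] at hm
    refine mem_span_triple_apply hm ?_ ?_ ?_ <;> rw [v, if_neg] <;>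
      (rintro rfl; revert hi; decide)
  -- Modulo I_F the differential of the new form is A ω⁴∧ω⁵ + B ω⁶∧ω⁷, with A, B its components on
  -- ω², ω³.
  have hD : ∀ k : Fin 7, k = 0 ∨ k = 1 ∨ k = 2 → ∀ i j : Fin 7, 3 ≤ i → 3 ≤ j →
      extD (om' k) x (dualFrame om i x) (dualFrame om j x) =
      om' k x (dualFrame om 1 x) *
        wdg (om 3 x) (om 4 x) (dualFrame om i x) (dualFrame om j x) +
      om' k x (dualFrame om 2 x) *
        wdg (om 5 x) (om 6 x) (dualFrame om i x) (dualFrame om j x) := by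
    intro k hk i j hi hj
    obtain ⟨c, dc, e1, e2⟩ := H.expand_contact H.contact hx hx (hsec k hk)
    have z : ∀ l i : Fin 7, l = 0 ∨ l = 1 ∨ l = 2 → 3 ≤ i → om l x (dualFrame om i x) = 0 := by
      intro l i hl hi
      rw [v, if_neg]
      rintro rfl
      rcases hl with rfl | rfl | rfl <;> revert hi <;> decide
    rw [e2, H.eq₁ x hx _ _ (z 0 i (by simp) hi) (z 0 j (by simp) hj),
      H.eq₂ x hx _ _ (z 0 i (by simp) hi) (z 0 j (by simp) hj) (z 1 i (by simp) hi)
        (z 1 j (by simp) hj),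
      H.eq₃ x hx _ _ (z 0 i (by simp) hi) (z 0 j (by simp) hj) (z 2 i (by simp) hi)
        (z 2 j (by simp) hj), e1]
    simp only [wdg, z 0 i (by simp) hi, z 0 j (by simp) hj, z 1 i (by simp) hi,
      z 1 j (by simp) hj, z 2 i (by simp) hi, z 2 j (by simp) hj, add_apply,
      smul_apply, smul_eq_mul]
    simp [v]
  refine ⟨⟨?_, ?_⟩, ?_, ?_⟩
  · have := hD 0 (by simp) 3 4 (by decide) (by decide)
    rw [H'.eq₁ x hx _ _ (hperp 3 (by decide) 0 (by simp)) (hperp 4 (by decide) 0 (by simp))] at this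
    simpa [wdg, hperp 3 (by decide), hperp 4 (by decide), v, eq_comm] using this
  · have := hD 0 (by simp) 5 6 (by decide) (by decide)
    rw [H'.eq₁ x hx _ _ (hperp 5 (by decide) 0 (by simp)) (hperp 6 (by decide) 0 (by simp))] at this
    simpa [wdg, hperp 5 (by decide), hperp 6 (by decide), v, eq_comm] using this
  · have key : ∀ i j : Fin 7, 3 ≤ i → 3 ≤ j →
        wdg (om' 3 x) (om' 4 x) (dualFrame om i x) (dualFrame om j x) =
        om' 1 x (dualFrame om 1 x) *
          wdg (om 3 x) (om 4 x) (dualFrame om i x) (dualFrame om j x) +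
        om' 1 x (dualFrame om 2 x) *
          wdg (om 5 x) (om 6 x) (dualFrame om i x) (dualFrame om j x) := by
      intro i j hi hj
      rw [← hD 1 (by simp) i j hi hj, H'.eq₂ x hx _ _ (hperp i hi 0 (by simp))
        (hperp j hj 0 (by simp)) (hperp i hi 1 (by simp)) (hperp j hj 1 (by simp))]
      simp [wdg, hperp i hi 2, hperp j hj 2]
    have k34 := key 3 4 (by decide) (by decide)
    have k56 := key 5 6 (by decide) (by decide)
    have k35 := key 3 5 (by decide) (by decide)
    have k36 := key 3 6 (by decide) (by decide)
    simp [wdg, v] at k34 k56 k35 k36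
    rw [← k34, ← k56]
    -- The Plücker relation q₃₄q₅₆ = q₃₅q₄₆ - q₃₆q₄₅ for a decomposable form; here q₃₅ = q₃₆ = 0.
    linear_combination (om' 3 x (dualFrame om 4 x) * om' 4 x (dualFrame om 6 x) -
      om' 3 x (dualFrame om 6 x) * om' 4 x (dualFrame om 4 x)) * k35 -
      (om' 3 x (dualFrame om 4 x) * om' 4 x (dualFrame om 5 x) -
      om' 3 x (dualFrame om 5 x) * om' 4 x (dualFrame om 4 x)) * k36
  · have key : ∀ i j : Fin 7, 3 ≤ i → 3 ≤ j →
        wdg (om' 5 x) (om' 6 x) (dualFrame om i x) (dualFrame om j x) =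
        om' 2 x (dualFrame om 1 x) *
          wdg (om 3 x) (om 4 x) (dualFrame om i x) (dualFrame om j x) +
        om' 2 x (dualFrame om 2 x) *
          wdg (om 5 x) (om 6 x) (dualFrame om i x) (dualFrame om j x) := by
      intro i j hi hj
      rw [← hD 2 (by simp) i j hi hj, H'.eq₃ x hx _ _ (hperp i hi 0 (by simp))
        (hperp j hj 0 (by simp)) (hperp i hi 2 (by simp)) (hperp j hj 2 (by simp))]
      simp [wdg, hperp i hi 1, hperp j hj 1]
    have k34 := key 3 4 (by decide) (by decide)
    have k56 := key 5 6 (by decide) (by decide)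
    have k35 := key 3 5 (by decide) (by decide)
    have k36 := key 3 6 (by decide) (by decide)
    simp [wdg, v] at k34 k56 k35 k36
    rw [← k34, ← k56]
    linear_combination (om' 5 x (dualFrame om 4 x) * om' 6 x (dualFrame om 6 x) -
      om' 5 x (dualFrame om 6 x) * om' 6 x (dualFrame om 4 x)) * k35 -
      (om' 5 x (dualFrame om 4 x) * om' 6 x (dualFrame om 5 x) -
      om' 5 x (dualFrame om 5 x) * om' 6 x (dualFrame om 4 x)) * k36

/-- Two coframes with the same labelling of the characteristic systems have the same sign. -/
lemma sign_eq_of_ne_zero (H : IsWeakCoframe iF V om ε) (H' : IsWeakCoframe iF V om' ε')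
    {p : E7} (hp : p ∈ V) (hne : om' 1 p (dualFrame om 1 p) ≠ 0) : ε = ε' := by
  have v := fun i j => H.apply_dualFrame hp i j
  have hcont : ∀ k i : Fin 7, ContinuousAt (fun x => om' k x (dualFrame om i x)) p := fun k i =>
    (((H'.smooth k).clm_apply (H.smooth_dualFrame i)).continuousOn).continuousAt
      (H.isOpen.mem_nhds hp)
  have hm : ∀ k : Fin 7, k = 0 ∨ k = 1 ∨ k = 2 → ∃ x y z : ℝ,
      om k p = x • om' 0 p + y • om' 1 p + z • om' 2 p := by
    intro k hk
    have := H.mem_contact hp hk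
    rw [H'.contact p hp] at this
    obtain ⟨x, y, z, h⟩ := Submodule.mem_span_triple.1 this
    exact ⟨x, y, z, h.symm⟩
  have hz : ∀ x ∈ V, ∀ k : Fin 7, k = 0 ∨ k = 1 ∨ k = 2 → ∀ i : Fin 7, 3 ≤ i →
      om' k x (dualFrame om i x) = 0 := by
    intro x hx k hk i hi
    have := H'.mem_contact hx hk
    rw [H.contact x hx] at this
    refine mem_span_triple_apply this ?_ ?_ ?_ <;> rw [H.apply_dualFrame hx, if_neg] <;>
      (rintro rfl; revert hi; decide)
  have T := H.transition H' hp
  have a12 : om' 1 p (dualFrame om 2 p) = 0 := by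
    rcases mul_eq_zero.1 T.2.1 with h | h
    exacts [absurd h hne, h]
  -- Otherwise `dualFrame om 2 p` would be annihilated by all of I_F, which contains `om 2 p`.
  have hne2 : om' 2 p (dualFrame om 2 p) ≠ 0 := by
    intro h0
    obtain ⟨x, y, z, h⟩ := hm 2 (by simp)
    have := congrArg (fun ξ : Cov => ξ (dualFrame om 2 p)) h
    simp [v, T.1.2, a12, h0] at this
  -- On such a neighbourhood the vanishing products of `transition` force the off-diagonal
  -- components to vanish identically, as `expand` requires.
  have hU : ∃ U : Set E7, IsOpen U ∧ p ∈ U ∧ U ⊆ V ∧ ∀ x ∈ U,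
      om' 1 x (dualFrame om 1 x) ≠ 0 ∧ om' 2 x (dualFrame om 2 x) ≠ 0 := by
    have := ((hcont 1 1).eventually_ne hne).and (((hcont 2 2).eventually_ne hne2).and
      (H.isOpen.mem_nhds hp))
    obtain ⟨U, h1, h2, h3⟩ := eventually_nhds_iff.1 this
    exact ⟨U, h2, h3, fun x hx => (h1 x hx).2.2, fun x hx => ⟨(h1 x hx).1, (h1 x hx).2.1⟩⟩
  obtain ⟨U, hUo, hpU, hUV, hUne⟩ := hU
  obtain ⟨d0, e0, E0⟩ := H.expand hp hUo hpU ((H'.smooth 0).mono hUV) {0} (by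
    intro x hxU hxV i hi
    have := H.transition H' hxV
    fin_cases i <;> simp at hi ⊢
    exacts [this.1.1, this.1.2, hz x hxV 0 (by simp) 3 (by decide),
      hz x hxV 0 (by simp) 4 (by decide), hz x hxV 0 (by simp) 5 (by decide),
      hz x hxV 0 (by simp) 6 (by decide)])
  obtain ⟨d1, e1, E1⟩ := H.expand hp hUo hpU ((H'.smooth 1).mono hUV) {0, 1} (by
    intro x hxU hxV i hi
    have := (H.transition H' hxV).2.1
    fin_cases i <;> simp at hi ⊢
    exacts [(mul_eq_zero.1 this).resolve_left (hUne x hxU).1, hz x hxV 1 (by simp) 3 (by decide),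
      hz x hxV 1 (by simp) 4 (by decide), hz x hxV 1 (by simp) 5 (by decide),
      hz x hxV 1 (by simp) 6 (by decide)])
  obtain ⟨d2, e2, E2⟩ := H.expand hp hUo hpU ((H'.smooth 2).mono hUV) {0, 2} (by
    intro x hxU hxV i hi
    have := (H.transition H' hxV).2.2
    fin_cases i <;> simp at hi ⊢
    exacts [(mul_eq_zero.1 this).resolve_right (hUne x hxU).2, hz x hxV 2 (by simp) 3 (by decide),
      hz x hxV 2 (by simp) 4 (by decide), hz x hxV 2 (by simp) 5 (by decide),
      hz x hxV 2 (by simp) 6 (by decide)])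
  rw [Finset.sum_singleton] at e0
  rw [Finset.sum_pair (by decide)] at e1 e2
  simp only [Finset.sum_singleton] at E0
  simp only [Finset.sum_pair (show (0 : Fin 7) ≠ 1 by decide)] at E1
  simp only [Finset.sum_pair (show (0 : Fin 7) ≠ 2 by decide)] at E2
  set m := om' 0 p (dualFrame om 0 p)
  set a := om' 1 p (dualFrame om 1 p)
  set b := om' 2 p (dualFrame om 2 p)
  set c := om' 1 p (dualFrame om 0 p)
  set c' := om' 2 p (dualFrame om 0 p)
  have v0 : ∀ i, om' 0 p (dualFrame om i p) = if i = 0 then m else 0 := fun i => by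
    rw [e0]; simp [v, eq_comm]
  have v1 : ∀ i, om' 1 p (dualFrame om i p) = if i = 0 then c else if i = 1 then a else 0 := by
    intro i; rw [e1]; fin_cases i <;> simp [v]
  have v2 : ∀ i, om' 2 p (dualFrame om i p) = if i = 0 then c' else if i = 2 then b else 0 := by
    intro i; rw [e2]; fin_cases i <;> simp [v]
  -- At p the new forms are mω¹, aω² + cω¹, bω³ + c'ω¹. `F0`, `F1`, `F2` compare the two expressions
  -- of their differentials on vectors of the dual frame; evaluations on selected pairs follow.
  have F0 : ∀ i j : Fin 7, i ≠ 0 → j ≠ 0 →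
      m * (wdg (om 2 p) (om 5 p) (dualFrame om i p) (dualFrame om j p) +
        wdg (om 1 p) (om 3 p) (dualFrame om i p) (dualFrame om j p)) =
      wdg (om' 2 p) (om' 5 p) (dualFrame om i p) (dualFrame om j p) +
        wdg (om' 1 p) (om' 3 p) (dualFrame om i p) (dualFrame om j p) := by
    intro i j hi hj
    have := E0 (dualFrame om i p) (dualFrame om j p)
    rw [H.eq₁ p hp _ _ (by simp [v, hi.symm]) (by simp [v, hj.symm]),
      H'.eq₁ p hp _ _ (by simp [v0, hi]) (by simp [v0, hj])] at this
    rw [this]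
    simp [wdg, v, hi.symm, hj.symm]
  have F1 : ∀ i j : Fin 7, i ≠ 0 → j ≠ 0 → i ≠ 1 → j ≠ 1 →
      a * (wdg (om 3 p) (om 4 p) (dualFrame om i p) (dualFrame om j p) +
        wdg (om 2 p) (om 6 p) (dualFrame om i p) (dualFrame om j p)) +
      c * wdg (om 2 p) (om 5 p) (dualFrame om i p) (dualFrame om j p) =
      wdg (om' 3 p) (om' 4 p) (dualFrame om i p) (dualFrame om j p) +
        wdg (om' 2 p) (om' 6 p) (dualFrame om i p) (dualFrame om j p) := by
    intro i j hi hj hi1 hj1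
    have := E1 (dualFrame om i p) (dualFrame om j p)
    rw [H.eq₁ p hp _ _ (by simp [v, hi.symm]) (by simp [v, hj.symm]),
      H.eq₂ p hp _ _ (by simp [v, hi.symm]) (by simp [v, hj.symm]) (by simp [v, hi1.symm])
        (by simp [v, hj1.symm]),
      H'.eq₂ p hp _ _ (by simp [v0, hi]) (by simp [v0, hj]) (by simp [v1, hi, hi1])
        (by simp [v1, hj, hj1])] at this
    rw [this]
    simp [wdg, v, hi.symm, hj.symm, hi1.symm, hj1.symm]
    ring
  have F2 : ∀ i j : Fin 7, i ≠ 0 → j ≠ 0 → i ≠ 2 → j ≠ 2 →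
      b * (wdg (om 5 p) (om 6 p) (dualFrame om i p) (dualFrame om j p) +
        ε * wdg (om 1 p) (om 4 p) (dualFrame om i p) (dualFrame om j p)) +
      c' * wdg (om 1 p) (om 3 p) (dualFrame om i p) (dualFrame om j p) =
      wdg (om' 5 p) (om' 6 p) (dualFrame om i p) (dualFrame om j p) +
        ε' * wdg (om' 1 p) (om' 4 p) (dualFrame om i p) (dualFrame om j p) := by
    intro i j hi hj hi1 hj1
    have := E2 (dualFrame om i p) (dualFrame om j p)
    rw [H.eq₁ p hp _ _ (by simp [v, hi.symm]) (by simp [v, hj.symm]),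
      H.eq₃ p hp _ _ (by simp [v, hi.symm]) (by simp [v, hj.symm]) (by simp [v, hi1.symm])
        (by simp [v, hj1.symm]),
      H'.eq₃ p hp _ _ (by simp [v0, hi]) (by simp [v0, hj]) (by simp [v2, hi, hi1])
        (by simp [v2, hj, hj1])] at this
    rw [this]
    simp [wdg, v, hi.symm, hj.symm, hi1.symm, hj1.symm]
    ring
  have r1 := F0 1 3 (by decide) (by decide)
  have r2 := F0 1 4 (by decide) (by decide)
  have r3 := F0 1 6 (by decide) (by decide)
  have r4 := F0 2 5 (by decide) (by decide)
  have r5 := F0 2 4 (by decide) (by decide)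
  have r6 := F0 2 6 (by decide) (by decide)
  have s1 := F1 3 4 (by decide) (by decide) (by decide) (by decide)
  have s2 := F1 3 6 (by decide) (by decide) (by decide) (by decide)
  have s3 := F1 2 6 (by decide) (by decide) (by decide) (by decide)
  have t1 := F2 5 6 (by decide) (by decide) (by decide) (by decide)
  have t2 := F2 5 4 (by decide) (by decide) (by decide) (by decide)
  have t3 := F2 1 4 (by decide) (by decide) (by decide) (by decide)
  simp [wdg, v, v1, v2] at r1 r2 r3 r4 r5 r6 s1 s2 s3 t1 t2 t3
  have p34 := r2.resolve_left hne
  have p36 := r3.resolve_left hne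
  have p54 := r5.resolve_left hne2
  have p56 := r6.resolve_left hne2
  simp only [p34, p36, p54, p56, zero_mul, sub_zero] at s1 s2 s3 t1 t2 t3
  have p33 : om' 3 p (dualFrame om 3 p) ≠ 0 := fun h => hne (by rw [s1, h, zero_mul])
  have p55 : om' 5 p (dualFrame om 5 p) ≠ 0 := fun h => hne2 (by rw [t1, h, zero_mul])
  have p46 : om' 4 p (dualFrame om 6 p) = 0 := (mul_eq_zero.1 s2.symm).resolve_left p33
  have p64 : om' 6 p (dualFrame om 4 p) = 0 := by
    have : om' 5 p (dualFrame om 5 p) * om' 6 p (dualFrame om 4 p) = 0 := by linarith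
    exact (mul_eq_zero.1 this).resolve_left p55
  simp only [p46, p64, mul_zero, zero_add] at s3 t3
  -- Write Pᵢ for `om' i p (dualFrame om i p)`. The evaluations give m = aP₃ = bP₅, a = P₃P₄ = bP₆,
  -- b = P₅P₆ and εb = ε'aP₄; eliminating the Pᵢ leaves fourth powers of a and b.
  have q1 : a * om' 5 p (dualFrame om 5 p) = b ^ 2 := by
    linear_combination om' 5 p (dualFrame om 5 p) * s3 - b * t1
  have q2 : b * ε * om' 3 p (dualFrame om 3 p) = ε' * a ^ 2 := by
    linear_combination om' 3 p (dualFrame om 3 p) * t3 - ε' * a * s1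
  have q3 : b ^ 4 * ε = ε' * a ^ 4 := by
    linear_combination a ^ 2 * q2 + a * b * ε * (r1 - r4) - b ^ 2 * ε * q1
  have ha : 0 < a ^ 4 := by positivity
  have hb : 0 < b ^ 4 := by positivity
  rcases H.sign with rfl | rfl <;> rcases H'.sign with rfl | rfl <;>
    first | rfl | (exfalso; linarith)

/-- The sign in the structure equations does not depend on the coframe. -/
lemma sign_unique {V' : Set E7} (H : IsWeakCoframe iF V om ε) (H' : IsWeakCoframe iF V' om' ε')
    {p : E7} (hp : p ∈ V) (hp' : p ∈ V') : ε = ε' := by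
  have K := H.mono (H.isOpen.inter H'.isOpen) Set.inter_subset_left
  have K' := H'.mono (H.isOpen.inter H'.isOpen) Set.inter_subset_right
  have hpK : p ∈ V ∩ V' := ⟨hp, hp'⟩
  -- A vanishing component means that the labellings are opposite. The swapped coframe then works:
  -- otherwise `dualFrame om 1 p` would be annihilated by all of I_F.
  by_cases h : om' 1 p (dualFrame om 1 p) = 0
  · refine K.sign_eq_of_ne_zero K'.swap hpK fun h2 => ?_
    simp only [swapCoframe, Matrix.cons_val] at h2
    have hm := K.mem_contact hpK (k := 1) (by simp)
    rw [K'.contact p hpK] at hm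
    have := mem_span_triple_apply hm (K.transition K' hpK).1.1 h h2
    rw [K.apply_dualFrame hpK] at this
    simp at this
  · exact K.sign_eq_of_ne_zero K' hpK h

end IsWeakCoframe

/-! ### Pullback and contact equivalences -/

/-- The exterior derivative commutes with pullback. -/
lemma extD_pullback {F : Type*} [NormedAddCommGroup F] [NormedSpace ℝ F] {φ : F → (F →L[ℝ] ℝ)}
    {Φ : E7 → F} {p : E7} (hφ : DifferentiableAt ℝ φ (Φ p)) (hΦ : ContDiffAt ℝ ∞ Φ p) (X Y : E7) :
    extD (fun x => (φ (Φ x)).comp (fderiv ℝ Φ x)) p X Y =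
      fderiv ℝ φ (Φ p) (fderiv ℝ Φ p X) (fderiv ℝ Φ p Y) -
      fderiv ℝ φ (Φ p) (fderiv ℝ Φ p Y) (fderiv ℝ Φ p X) := by
  have h1 : DifferentiableAt ℝ Φ p := hΦ.differentiableAt (by simp)
  have h2 : DifferentiableAt ℝ (fderiv ℝ Φ) p :=
    (hΦ.fderiv_right (m := ∞) (by simp)).differentiableAt (by simp)
  have h3 : DifferentiableAt ℝ (fun x => φ (Φ x)) p := hφ.comp p h1
  have hs : IsSymmSndFDerivAt ℝ Φ p := hΦ.isSymmSndFDerivAt (by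
    rw [minSmoothness_of_isRCLikeNormedField]; exact WithTop.coe_le_coe.2 le_top)
  have h4 : fderiv ℝ (fun x => φ (Φ x)) p = (fderiv ℝ φ (Φ p)).comp (fderiv ℝ Φ p) :=
    fderiv_comp p hφ h1
  have h5 := hs X Y
  simp only [extD, fderiv_clm_comp h3 h2, h4]
  simp [h5]

namespace IsWeakCoframe

/-- Pullback of a coframe by a contact equivalence. -/
lemma pullback {S S' : Set E7} {iF iF' : E7 → J2} {U V : Set E7} {Φ : E7 → E7} {ε : ℝ}
    {om : Fin 7 → E7 → Cov} (H : IsWeakCoframe iF' V om ε)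
    (hΦ : IsContactEquiv S iF S' iF' U Φ) :
    IsWeakCoframe iF (U ∩ Φ ⁻¹' V) (fun i x => (om i (Φ x)).comp (fderiv ℝ Φ x)) ε := by
  have hc : ContDiffOn ℝ ∞ Φ (U ∩ Φ ⁻¹' V) := hΦ.smooth.mono Set.inter_subset_left
  have hD : ∀ p ∈ U ∩ Φ ⁻¹' V, ∀ i X Y, extD (fun x => (om i (Φ x)).comp (fderiv ℝ Φ x)) p X Y =
      extD (om i) (Φ p) (fderiv ℝ Φ p X) (fderiv ℝ Φ p Y) := fun p hp i X Y =>
    extD_pullback (H.differentiableAt i hp.2)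
      (hΦ.smooth.contDiffAt (hΦ.isOpen.mem_nhds hp.1)) X Y
  refine ⟨⟨hΦ.smooth.continuousOn.isOpen_inter_preimage hΦ.isOpen H.isOpen, fun i => ?_,
    fun p hp => ?_⟩, H.sign, fun p hp => ?_, ?_, ?_, ?_⟩
  · exact ((H.smooth i).comp hc fun x hx => hx.2).clm_comp
      ((hΦ.smooth.fderiv_of_isOpen hΦ.isOpen (by simp)).mono Set.inter_subset_left)
  · rw [linearIndependent_iff_ker]
    intro X hX
    have := linearIndependent_iff_ker.1 (H.linInd _ hp.2) (fderiv ℝ Φ p X) hX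
    exact (hΦ.localDiffeo p hp.1).1 (by rw [this, map_zero])
  · rw [← hΦ.pullback p hp.1, H.contact _ hp.2, Submodule.map_span]
    simp only [Set.image_insert_eq, Set.image_singleton]
    rfl
  · intro p hp X Y hX hY
    rw [hD p hp]
    exact H.eq₁ _ hp.2 _ _ hX hY
  · intro p hp X Y hX hY hX' hY'
    rw [hD p hp]
    exact H.eq₂ _ hp.2 _ _ hX hY hX' hY'
  · intro p hp X Y hX hY hX' hY'
    rw [hD p hp]
    exact H.eq₃ _ hp.2 _ _ hX hY hX' hY'

end IsWeakCoframe

/-! ### Torsion coframes: class of the characteristic systems and normalization -/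

/-- A smooth coframe whose first three forms span the contact system and which satisfies
structure equations with torsion terms `ω³ ∧ γ` and `ω² ∧ δ`. -/
structure IsTorsionCoframe (iF : E7 → J2) (V : Set E7) (η : Fin 7 → E7 → Cov) (γ δ : E7 → Cov) :
    Prop extends IsCoframe V η where
  contact : ∀ p ∈ V, contactSystem iF p = Submodule.span ℝ {η 0 p, η 1 p, η 2 p}
  smooth_γ : ContDiffOn ℝ ∞ γ V
  smooth_δ : ContDiffOn ℝ ∞ δ V
  eq₁ : ∀ p ∈ V, ∀ X Y, η 0 p X = 0 → η 0 p Y = 0 → extD (η 0) p X Y =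
    wdg (η 2 p) (η 5 p) X Y + wdg (η 1 p) (η 3 p) X Y
  eq₂ : ∀ p ∈ V, ∀ X Y, η 0 p X = 0 → η 0 p Y = 0 → η 1 p X = 0 → η 1 p Y = 0 →
    extD (η 1) p X Y = wdg (η 3 p) (η 4 p) X Y + wdg (η 2 p) (γ p) X Y
  eq₃ : ∀ p ∈ V, ∀ X Y, η 0 p X = 0 → η 0 p Y = 0 → η 2 p X = 0 → η 2 p Y = 0 →
    extD (η 2) p X Y = wdg (η 5 p) (η 6 p) X Y + wdg (η 1 p) (δ p) X Y

namespace IsTorsionCoframe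

variable {iF : E7 → J2} {V : Set E7} {η : Fin 7 → E7 → Cov} {γ δ : E7 → Cov}

lemma swap (H : IsTorsionCoframe iF V η γ δ) :
    IsTorsionCoframe iF V (swapCoframe 1 η) δ γ := by
  refine ⟨H.toIsCoframe.swap one_ne_zero, fun p hp => ?_, H.smooth_δ, H.smooth_γ, ?_, ?_, ?_⟩
  · rw [H.contact p hp, span_swapCoframe one_ne_zero]
  · intro p hp X Y hX hY
    simp only [swapCoframe, Matrix.cons_val, one_smul] at hX hY ⊢
    rw [H.eq₁ p hp X Y hX hY, add_comm]
  · intro p hp X Y hX hY hX' hY'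
    simp only [swapCoframe, Matrix.cons_val, one_smul] at hX hY hX' hY' ⊢
    exact H.eq₃ p hp X Y hX hY hX' hY'
  · intro p hp X Y hX hY hX' hY'
    simp only [swapCoframe, Matrix.cons_val, one_smul] at hX hY hX' hY' ⊢
    exact H.eq₂ p hp X Y hX hY hX' hY'

lemma dualFrame_swap (H : IsTorsionCoframe iF V η γ δ) {p : E7} (hp : p ∈ V) :
    dualFrame (swapCoframe 1 η) 6 p = dualFrame η 4 p := by
  refine H.vec_ext hp fun j => ?_
  have h := H.swap.apply_dualFrame hp 6
  rw [H.apply_dualFrame hp]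
  generalize dualFrame (swapCoframe 1 η) 6 p = Z at h ⊢
  have h0 := h 0
  have h1 := h 1
  have h2 := h 2
  have h3 := h 3
  have h4 := h 4
  have h5 := h 5
  have h6 := h 6
  simp [swapCoframe] at h0 h1 h2 h3 h4 h5 h6
  fin_cases j <;> simp [*]

lemma isCharSystem (H : IsTorsionCoframe iF V η γ δ) :
    IsCharSystem iF V fun p => Submodule.span ℝ {η 0 p, η 1 p} := by
  have hm : ∀ p ∈ V, ∀ X, (∀ ξ ∈ contactSystem iF p, ξ X = 0) →
      η 0 p X = 0 ∧ η 1 p X = 0 ∧ η 2 p X = 0 := by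
    intro p hp X hX
    rw [H.contact p hp] at hX
    exact ⟨hX _ (Submodule.subset_span (by simp)), hX _ (Submodule.subset_span (by simp)),
      hX _ (Submodule.subset_span (by simp))⟩
  refine H.toIsCoframe.isCharSystem H.contact ?_ (η 3) (η 4) ?_
  · intro p hp X Y hX hY
    obtain ⟨x0, x1, x2⟩ := hm p hp X hX
    obtain ⟨y0, y1, y2⟩ := hm p hp Y hY
    rw [H.eq₁ p hp X Y x0 y0]
    simp [wdg, x1, x2, y1, y2]
  · intro p hp X Y hX hY
    obtain ⟨x0, x1, x2⟩ := hm p hp X hX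
    obtain ⟨y0, y1, y2⟩ := hm p hp Y hY
    rw [H.eq₂ p hp X Y x0 y0 x1 y1]
    simp [wdg, x2, y2]

/-- `η 6` enters the differentials of `η 0` and `η 1`, modulo {`η 0`, `η 1`}, only through γ. If γ
has no `η 6` component, the dual vector is therefore a Cauchy characteristic, and the Cartan system
is proper. -/
lemma classAt_ne (H : IsTorsionCoframe iF V η γ δ) {p : E7} (hp : p ∈ V)
    (h0 : γ p (dualFrame η 6 p) = 0) :
    classAt (fun p => Submodule.span ℝ {η 0 p, η 1 p}) p ≠ 7 := by
  have v := fun i j => H.apply_dualFrame hp i j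
  have hX : dualFrame η 6 p ∈ cauchyCharAt (fun p => Submodule.span ℝ {η 0 p, η 1 p}) p := by
    refine ⟨fun ξ hξ => mem_span_pair_apply hξ (by simp [v]) (by simp [v]), ?_⟩
    intro U φ hpU hφ
    have hd : DifferentiableAt ℝ φ p :=
      (hφ.smooth.contDiffAt (hφ.isOpen.mem_nhds hpU)).differentiableAt (by simp)
    obtain ⟨ζ, hζ, hζY⟩ := contract_d hd (dualFrame η 6 p)
    refine ⟨ζ, ?_, hζ⟩
    obtain ⟨dc, -, hD⟩ := H.expand hp hφ.isOpen hpU hφ.smooth {0, 1} (by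
      intro x hxU hxV i hi
      simp only [Finset.mem_insert, Finset.mem_singleton, not_or] at hi
      refine mem_span_pair_apply (hφ.mem x hxU) ?_ ?_ <;> rw [H.apply_dualFrame hxV, if_neg] <;>
        tauto)
    simp only [Finset.sum_pair (show (0 : Fin 7) ≠ 1 by decide)] at hD
    have hz : ∀ i : Fin 7, 2 ≤ i → ζ (dualFrame η i p) = 0 := by
      intro i hi
      have i0 : (0 : Fin 7) ≠ i := by rintro rfl; revert hi; decide
      have i1 : (1 : Fin 7) ≠ i := by rintro rfl; revert hi; decide
      rw [hζY, hD, H.eq₁ p hp _ _ (by simp [v]) (by simp [v, i0]),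
        H.eq₂ p hp _ _ (by simp [v]) (by simp [v, i0]) (by simp [v]) (by simp [v, i1])]
      simp [wdg, v, i0, i1, h0]
    rw [H.cov_eq_sum hp ζ, Submodule.mem_span_pair]
    refine ⟨ζ (dualFrame η 0 p), ζ (dualFrame η 1 p), ?_⟩
    simp [Fin.sum_univ_seven, hz]
  intro hc
  have hle : cartanAt (fun p => Submodule.span ℝ {η 0 p, η 1 p}) p ≤
      LinearMap.ker (evalAt (dualFrame η 6 p)) := iInf₂_le _ hX
  have htop : cartanAt (fun p => Submodule.span ℝ {η 0 p, η 1 p}) p = ⊤ :=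
    Submodule.eq_top_of_finrank_eq (by rw [finrank_cov]; exact hc)
  rw [htop, top_le_iff] at hle
  have : η 6 p ∈ LinearMap.ker (evalAt (dualFrame η 6 p)) := by rw [hle]; trivial
  have h1 : η 6 p (dualFrame η 6 p) = 0 := this
  simp [v] at h1

/-- Normalization of the torsion terms. -/
lemma exists_isWeakCoframe (C : IsTorsionCoframe iF V η γ δ) {ε : ℝ}
    (hsymm : ∀ p ∈ V, γ p (dualFrame η 4 p) = δ p (dualFrame η 6 p))
    (hε : ε = 1 ∨ ε = -1) {p : E7} (hp : p ∈ V)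
    (hpos : 0 < ε * (γ p (dualFrame η 6 p) * δ p (dualFrame η 4 p))) :
    ∃ V' om, p ∈ V' ∧ V' ⊆ V ∧ IsWeakCoframe iF V' om ε := by
  let g : Fin 7 → E7 → ℝ := fun i x => γ x (dualFrame η i x)
  let f : Fin 7 → E7 → ℝ := fun i x => δ x (dualFrame η i x)
  have hg : ∀ i, ContDiffOn ℝ ∞ (g i) V := fun i => C.smooth_γ.clm_apply (C.smooth_dualFrame i)
  have hf : ∀ i, ContDiffOn ℝ ∞ (f i) V := fun i => C.smooth_δ.clm_apply (C.smooth_dualFrame i)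
  have hγs : ∀ x ∈ V, ∀ X, γ x X = ∑ i, g i x * η i x X := fun x hx X => by
    conv_lhs => rw [C.cov_eq_sum hx (γ x)]
    simp [g]
  have hδs : ∀ x ∈ V, ∀ X, δ x X = ∑ i, f i x * η i x X := fun x hx X => by
    conv_lhs => rw [C.cov_eq_sum hx (δ x)]
    simp [f]
  let V' : Set E7 := V ∩ (fun x => ε * (g 6 x * f 4 x)) ⁻¹' Set.Ioi 0
  have hV' : IsOpen V' := (continuousOn_const.mul ((hg 6).continuousOn.mul
    (hf 4).continuousOn)).isOpen_inter_preimage C.isOpen isOpen_Ioi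
  have hVV : V' ⊆ V := Set.inter_subset_left
  have hne : ∀ x ∈ V', g 6 x ≠ 0 ∧ f 4 x ≠ 0 := fun x hx => by
    have h : 0 < ε * (g 6 x * f 4 x) := hx.2
    constructor <;> (intro h0; simp [h0] at h)
  -- With `η 2` kept fixed, the scalings of the other forms are dictated by the equations: ω⁶∧ω⁷
  -- needs m · a · g₆ = 1, and ε ω²∧ω⁵ needs ε a⁴ g₆ = f₄. The latter has a positive real solution
  -- exactly when ε g₆ f₄ > 0.
  let a : E7 → ℝ := fun x => √√(ε * (f 4 x / g 6 x))
  have hquot : ∀ x ∈ V', 0 < ε * (f 4 x / g 6 x) := fun x hx => by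
    have h : 0 < ε * (g 6 x * f 4 x) := hx.2
    have h2 := (hne x hx).1
    have : ε * (f 4 x / g 6 x) = ε * (g 6 x * f 4 x) / g 6 x ^ 2 := by field_simp
    rw [this]; positivity
  have ha4 : ∀ x ∈ V', a x ^ 4 * g 6 x = ε * f 4 x := fun x hx => by
    have h2 := (hne x hx).1
    have : a x ^ 4 = (a x ^ 2) ^ 2 := by ring
    rw [this, Real.sq_sqrt (Real.sqrt_nonneg _), Real.sq_sqrt (hquot x hx).le]
    field_simp
  have hane : ∀ x ∈ V', a x ≠ 0 := fun x hx =>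
    (Real.sqrt_pos.2 (Real.sqrt_pos.2 (hquot x hx))).ne'
  have smη : ∀ i, ContDiffOn ℝ ∞ (η i) V' := fun i => (C.smooth i).mono hVV
  have smg : ∀ i, ContDiffOn ℝ ∞ (g i) V' := fun i => (hg i).mono hVV
  have smf : ∀ i, ContDiffOn ℝ ∞ (f i) V' := fun i => (hf i).mono hVV
  have sma : ContDiffOn ℝ ∞ a V' :=
    ((contDiffOn_const.mul ((smf 4).div (smg 6) fun x hx => (hne x hx).1)).sqrt
      fun x hx => (hquot x hx).ne').sqrt fun x hx => (Real.sqrt_pos.2 (hquot x hx)).ne'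
  let m : E7 → ℝ := fun x => (a x * g 6 x)⁻¹
  have smm : ContDiffOn ℝ ∞ m V' :=
    (sma.mul (smg 6)).inv fun x hx => mul_ne_zero (hane x hx) (hne x hx).1
  -- These shifts absorb the cross coefficients g₄ and f₆. The first structure equation only allows
  -- equal shifts of `η 3` and `η 5`, whose contributions then cancel; this is why `hsymm` is
  -- required.
  let η3 : E7 → Cov := fun x => η 3 x + g 4 x • η 2 x
  let η5 : E7 → Cov := fun x => η 5 x + g 4 x • η 1 x
  -- The term in g₃ is absorbed through η3∧η4. Adding a multiple of η3 leaves that product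
  -- unchanged, so it is free to absorb f₃ in the other equation; likewise for η6 with f₅ and g₅.
  let η4 : E7 → Cov := fun x => η 4 x - g 3 x • η 2 x + (f 3 x / f 4 x) • η3 x
  let η6 : E7 → Cov := fun x => η 6 x - f 5 x • η 1 x + (g 5 x / g 6 x) • η5 x
  have sm3 : ContDiffOn ℝ ∞ η3 V' := (smη 3).add ((smg 4).smul (smη 2))
  have sm5 : ContDiffOn ℝ ∞ η5 V' := (smη 5).add ((smg 4).smul (smη 1))
  have sm4 : ContDiffOn ℝ ∞ η4 V' := ((smη 4).sub ((smg 3).smul (smη 2))).add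
    (((smf 3).div (smf 4) fun x hx => (hne x hx).2).smul sm3)
  have sm6 : ContDiffOn ℝ ∞ η6 V' := ((smη 6).sub ((smf 5).smul (smη 1))).add
    (((smg 5).div (smg 6) fun x hx => (hne x hx).1).smul sm5)
  let om : Fin 7 → E7 → Cov := ![fun x => m x • η 0 x, fun x => a x • η 1 x, η 2,
    fun x => (m x / a x) • η3 x, fun x => (a x ^ 2 / m x) • η4 x, fun x => m x • η5 x,
    fun x => (a x * g 6 x) • η6 x]
  have hmne : ∀ x ∈ V', m x ≠ 0 := fun x hx =>
    inv_ne_zero (mul_ne_zero (hane x hx) (hne x hx).1)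
  have diff : ∀ {h : E7 → ℝ}, ContDiffOn ℝ ∞ h V' → ∀ x ∈ V', DifferentiableAt ℝ h x :=
    fun hh x hx => (hh.contDiffAt (hV'.mem_nhds hx)).differentiableAt (by simp)
  refine ⟨V', om, ⟨hp, hpos⟩, hVV, ⟨hV', ?_, ?_⟩, hε, ?_, ?_, ?_, ?_⟩
  · intro i
    fin_cases i
    exacts [smm.smul (smη 0), sma.smul (smη 1), smη 2, (smm.div sma hane).smul sm3,
      ((sma.pow 2).div smm hmne).smul sm4, smm.smul sm5, (sma.mul (smg 6)).smul sm6]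
  · intro x hx
    rw [linearIndependent_iff_ker]
    intro X hX
    refine linearIndependent_iff_ker.1 (C.linInd x (hVV hx)) X ?_
    have h0 := hX 0
    have h1 := hX 1
    have h2 := hX 2
    have h3 := hX 3
    have h4 := hX 4
    have h5 := hX 5
    have h6 := hX 6
    simp [om, hmne x hx, hane x hx, (hne x hx).1] at h0 h1 h2 h3 h4 h5 h6
    simp [η3, η4, η5, η6, h1, h2] at h3 h4 h5 h6
    simp [h3, h5] at h4 h6
    intro i
    fin_cases i <;> assumption
  · intro x hx
    rw [C.contact x (hVV hx)]
    simp only [om, Matrix.cons_val]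
    simp only [Submodule.span_insert, Submodule.span_singleton_smul_eq (IsUnit.mk0 _ (hmne x hx)),
      Submodule.span_singleton_smul_eq (IsUnit.mk0 _ (hane x hx))]
  · intro x hx X Y hX hY
    simp only [om, Matrix.cons_val] at hX hY ⊢
    have hX0 : η 0 x X = 0 := by simpa [hmne x hx] using hX
    have hY0 : η 0 x Y = 0 := by simpa [hmne x hx] using hY
    rw [extD_smul (diff smm x hx) (C.differentiableAt 0 (hVV hx)), C.eq₁ x (hVV hx) X Y hX0 hY0]
    have h1 := hane x hx
    simp only [wdg, η3, η5, hX0, hY0, add_apply, smul_apply, smul_eq_mul]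
    field_simp
    ring
  · intro x hx X Y hX hY hX' hY'
    simp only [om, Matrix.cons_val] at hX hY hX' hY' ⊢
    have hX0 : η 0 x X = 0 := by simpa [hmne x hx] using hX
    have hY0 : η 0 x Y = 0 := by simpa [hmne x hx] using hY
    have hX1 : η 1 x X = 0 := by simpa [hane x hx] using hX'
    have hY1 : η 1 x Y = 0 := by simpa [hane x hx] using hY'
    rw [extD_smul (diff sma x hx) (C.differentiableAt 1 (hVV hx)),
      C.eq₂ x (hVV hx) X Y hX0 hY0 hX1 hY1]
    have h1 := hane x hx
    have h2 := hmne x hx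
    obtain ⟨h3, h4⟩ := hne x hx
    simp only [wdg, η3, η5, η4, η6, hX0, hY0, hX1, hY1, add_apply, sub_apply, smul_apply,
      smul_eq_mul, hγs x (hVV hx), Fin.sum_univ_seven]
    field_simp
    ring
  · intro x hx X Y hX hY hX' hY'
    simp only [om, Matrix.cons_val] at hX hY hX' hY' ⊢
    have hX0 : η 0 x X = 0 := by simpa [hmne x hx] using hX
    have hY0 : η 0 x Y = 0 := by simpa [hmne x hx] using hY
    rw [C.eq₃ x (hVV hx) X Y hX0 hY0 hX' hY']
    have h1 := hane x hx
    obtain ⟨h3, h4⟩ := hne x hx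
    have h5 : g 4 x = f 6 x := hsymm x (hVV hx)
    have h6 : ε * a x ^ 4 * g 6 x = f 4 x := by
      have : ε * ε = 1 := by rcases hε with rfl | rfl <;> norm_num
      linear_combination ε * ha4 x hx + f 4 x * this
    have h7 : a x * (a x ^ 2 / m x) = a x ^ 4 * g 6 x := by
      simp only [m]; field_simp
    have h8 : m x * (a x * g 6 x) = 1 := by
      simp only [m]; field_simp
    have e1 : wdg (m x • η5 x) ((a x * g 6 x) • η6 x) X Y = wdg (η5 x) (η6 x) X Y := by
      simp only [wdg, smul_apply, smul_eq_mul]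
      linear_combination (η5 x X * η6 x Y - η5 x Y * η6 x X) * h8
    have e2 : ε * wdg (a x • η 1 x) ((a x ^ 2 / m x) • η4 x) X Y =
        f 4 x * wdg (η 1 x) (η4 x) X Y := by
      simp only [wdg, smul_apply, smul_eq_mul]
      linear_combination (η 1 x X * η4 x Y - η 1 x Y * η4 x X) * (ε * h7 + h6)
    rw [e1, e2]
    simp only [wdg, η3, η5, η4, η6, hX0, hY0, hX', hY', add_apply, sub_apply, smul_apply,
      smul_eq_mul, hδs x (hVV hx), Fin.sum_univ_seven, h5]
    field_simp
    ring

end IsTorsionCoframe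

/-! ### The contact forms of a parametrized equation -/

/-- The differential of the `i`-th jet coordinate, pulled back to the parameter space. -/
def dcoord (iF : E7 → J2) (i : Fin 8) (x : E7) : Cov := (dJ i).comp (fderiv ℝ iF x)

/-- The 1-form `dwᵢ - wⱼ dw₀ - wₖ dw₁` on `J²`. -/
def jetForm (i j k : Fin 8) (w : J2) : J2 →L[ℝ] ℝ := dJ i - w j • dJ 0 - w k • dJ 1

lemma contactForm_apply (iF : E7 → J2) (x X : E7) :
    contactForm iF 0 x X = dcoord iF 2 x X - iF x 3 * dcoord iF 0 x X - iF x 4 * dcoord iF 1 x X ∧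
    contactForm iF 1 x X = dcoord iF 3 x X - iF x 5 * dcoord iF 0 x X - iF x 6 * dcoord iF 1 x X ∧
    contactForm iF 2 x X =
      dcoord iF 4 x X - iF x 6 * dcoord iF 0 x X - iF x 7 * dcoord iF 1 x X := by
  simp [contactForm, theta, dcoord]

lemma extD_jetForm {iF : E7 → J2} {x : E7} (h : ContDiffAt ℝ ∞ iF x) (i j k : Fin 8) (X Y : E7) :
    extD (fun x => (jetForm i j k (iF x)).comp (fderiv ℝ iF x)) x X Y =
      wdg (dcoord iF 0 x) (dcoord iF j x) X Y + wdg (dcoord iF 1 x) (dcoord iF k x) X Y := by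
  have hd : ∀ w, HasFDerivAt (jetForm i j k)
      (-((ContinuousLinearMap.proj j : J2 →L[ℝ] ℝ).smulRight (dJ 0)) -
        (ContinuousLinearMap.proj k : J2 →L[ℝ] ℝ).smulRight (dJ 1)) w := by
    intro w
    have e : jetForm i j k = fun w : J2 => dJ i + ((-((ContinuousLinearMap.proj j :
        J2 →L[ℝ] ℝ).smulRight (dJ 0)) - (ContinuousLinearMap.proj k : J2 →L[ℝ] ℝ).smulRight
        (dJ 1)) : J2 →L[ℝ] (J2 →L[ℝ] ℝ)) w := by
      funext w
      simp [jetForm]; abel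
    rw [e]
    exact (ContinuousLinearMap.hasFDerivAt _).const_add _
  rw [extD_pullback (hd _).differentiableAt h, (hd _).fderiv]
  simp [wdg, dcoord, dJ]
  ring

lemma extD_contactForm {iF : E7 → J2} {x : E7} (h : ContDiffAt ℝ ∞ iF x) (X Y : E7) :
    extD (contactForm iF 0) x X Y = wdg (dcoord iF 0 x) (dcoord iF 3 x) X Y +
      wdg (dcoord iF 1 x) (dcoord iF 4 x) X Y ∧
    extD (contactForm iF 1) x X Y = wdg (dcoord iF 0 x) (dcoord iF 5 x) X Y +
      wdg (dcoord iF 1 x) (dcoord iF 6 x) X Y ∧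
    extD (contactForm iF 2) x X Y = wdg (dcoord iF 0 x) (dcoord iF 6 x) X Y +
      wdg (dcoord iF 1 x) (dcoord iF 7 x) X Y :=
  ⟨extD_jetForm h 2 3 4 X Y, extD_jetForm h 3 5 6 X Y, extD_jetForm h 4 6 7 X Y⟩

lemma fderiv_apply_eq_sum (k : J2 → ℝ) (w V : J2) :
    fderiv ℝ k w V = ∑ i, pd i k w * V i := by
  conv_lhs => rw [pi_eq_sum_univ' V]
  simp [pd, mul_comm]

lemma fderiv_comp_apply {k : J2 → ℝ} {iF : E7 → J2} {x : E7} (hk : DifferentiableAt ℝ k (iF x))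
    (hi : DifferentiableAt ℝ iF x) (X : E7) :
    fderiv ℝ (fun x => k (iF x)) x X = ∑ i, pd i k (iF x) * dcoord iF i x X := by
  have : fderiv ℝ (fun x => k (iF x)) x = (fderiv ℝ k (iF x)).comp (fderiv ℝ iF x) :=
    fderiv_comp x hk hi
  rw [this, ContinuousLinearMap.comp_apply, fderiv_apply_eq_sum]
  rfl

lemma contDiffOn_pd {W : Set J2} {k : J2 → ℝ} (hW : IsOpen W) (hk : ContDiffOn ℝ ∞ k W)
    (i : Fin 8) : ContDiffOn ℝ ∞ (pd i k) W :=
  (hk.fderiv_of_isOpen hW (by simp)).clm_apply contDiffOn_const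

lemma pd_pd_comm {W : Set J2} {k : J2 → ℝ} (hW : IsOpen W) (hk : ContDiffOn ℝ ∞ k W)
    {w : J2} (hw : w ∈ W) (i j : Fin 8) : pd i (pd j k) w = pd j (pd i k) w := by
  have hc := hk.contDiffAt (hW.mem_nhds hw)
  have hs : IsSymmSndFDerivAt ℝ k w := hc.isSymmSndFDerivAt (by
    rw [minSmoothness_of_isRCLikeNormedField]; exact WithTop.coe_le_coe.2 le_top)
  have h2 : DifferentiableAt ℝ (fderiv ℝ k) w :=
    (hc.fderiv_right (m := ∞) (by simp)).differentiableAt (by simp)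
  have e : ∀ i j, pd i (pd j k) w = fderiv ℝ (fderiv ℝ k) w (Pi.single i 1) (Pi.single j 1) := by
    intro i j
    have := (h2.hasFDerivAt.clm_apply (hasFDerivAt_const (Pi.single j 1 : J2) w)).fderiv
    change fderiv ℝ (fun v => fderiv ℝ k v (Pi.single j 1)) w _ = _
    rw [this]; simp
  rw [e, e, hs]

/-! ### Hyperbolic equations: the roots of the characteristic equation -/

/-- The part of the domain of `F` where the equation is hyperbolic and `λ₊ > 0`. -/
def hypDomain (W : Set J2) (F : J2 → ℝ) : Set J2 := W ∩ {w | discr F w < 0 ∧ 0 < lamPlus F w}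

/-- The coefficient `F_t / λ₊`. -/
def gCoef (F : J2 → ℝ) (w : J2) : ℝ := Ft F w / lamPlus F w

/-- The coefficient `F_r / λ₊`. -/
def hCoef (F : J2 → ℝ) (w : J2) : ℝ := Fr F w / lamPlus F w

section Hyp

variable {W : Set J2} {F : J2 → ℝ} (hW : IsOpen W) (hF : ContDiffOn ℝ ∞ F W)
include hW hF

lemma contDiffOn_discr : ContDiffOn ℝ ∞ (discr F) W :=
  ((contDiffOn_pd hW hF 5).mul (contDiffOn_pd hW hF 7)).sub
    (contDiffOn_const.mul ((contDiffOn_pd hW hF 6).pow 2))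

lemma isOpen_hypDomain : IsOpen (hypDomain W F) := by
  have hc := (contDiffOn_discr hW hF).continuousOn
  have hl : ContinuousOn (lamPlus F) W :=
    ((contDiffOn_pd hW hF 6).continuousOn.div_const 2).add hc.abs.sqrt
  have h1 := hc.isOpen_inter_preimage hW (isOpen_Iio (a := (0 : ℝ)))
  have h2 := hl.isOpen_inter_preimage hW (isOpen_Ioi (a := (0 : ℝ)))
  have e : hypDomain W F = W ∩ discr F ⁻¹' Set.Iio 0 ∩ (W ∩ lamPlus F ⁻¹' Set.Ioi 0) := by
    ext w
    simp only [hypDomain, Set.mem_inter_iff, Set.mem_ofPred_eq, Set.mem_preimage, Set.mem_Iio,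
      Set.mem_Ioi]
    tauto
  rw [e]
  exact h1.inter h2

lemma contDiffOn_lamPlus : ContDiffOn ℝ ∞ (lamPlus F) (hypDomain W F) := by
  have hd : ContDiffOn ℝ ∞ (discr F) (hypDomain W F) :=
    (contDiffOn_discr hW hF).mono Set.inter_subset_left
  have h1 : ContDiffOn ℝ ∞ (fun w => Fs F w / 2 + √(-discr F w)) (hypDomain W F) :=
    (((contDiffOn_pd hW hF 6).mono Set.inter_subset_left).div_const 2).add
      (hd.neg.sqrt fun w hw => (neg_pos.2 hw.2.1).ne')
  refine h1.congr fun w hw => ?_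
  rw [lamPlus, abs_of_neg hw.2.1]

lemma contDiffOn_gCoef : ContDiffOn ℝ ∞ (gCoef F) (hypDomain W F) :=
  ((contDiffOn_pd hW hF 7).mono Set.inter_subset_left).div (contDiffOn_lamPlus hW hF)
    fun _ hw => hw.2.2.ne'

lemma contDiffOn_hCoef : ContDiffOn ℝ ∞ (hCoef F) (hypDomain W F) :=
  ((contDiffOn_pd hW hF 5).mono Set.inter_subset_left).div (contDiffOn_lamPlus hW hF)
    fun _ hw => hw.2.2.ne'

-- λ₊ is the larger root of λ² - F_s λ + F_r F_t = 0, hence F_s = λ₊ (1 + gh) and the symbol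
-- factors. The difference of the roots is 2√|Δ| = λ₊ (1 - gh), which gives positivity.
omit hW hF in
lemma coef_spec {w : J2} (hw : w ∈ hypDomain W F) :
    Fr F w = lamPlus F w * hCoef F w ∧ Ft F w = lamPlus F w * gCoef F w ∧
    Fs F w = lamPlus F w * (1 + gCoef F w * hCoef F w) ∧ 0 < 1 - gCoef F w * hCoef F w := by
  obtain ⟨-, hd, hl⟩ := hw
  have hne := hl.ne'
  have hq : 0 < √|discr F w| := Real.sqrt_pos.2 (abs_pos.2 hd.ne)
  have hs : √|discr F w| ^ 2 = 1 / 4 * Fs F w ^ 2 - Fr F w * Ft F w := by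
    rw [Real.sq_sqrt (abs_nonneg _), abs_of_neg hd, discr]; ring
  have h1 : lamPlus F w ^ 2 - Fs F w * lamPlus F w + Fr F w * Ft F w = 0 := by
    rw [lamPlus]; linear_combination hs
  refine ⟨by rw [hCoef]; field_simp, by rw [gCoef]; field_simp, ?_, ?_⟩
  · rw [gCoef, hCoef]; field_simp; linear_combination -h1
  · have : 1 - gCoef F w * hCoef F w = 2 * √|discr F w| / lamPlus F w := by
      rw [gCoef, hCoef]; field_simp
      have : 2 * √|discr F w| = 2 * lamPlus F w - Fs F w := by rw [lamPlus]; ring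
      linear_combination -h1 - lamPlus F w * this
    rw [this]; positivity

lemma pd_lam_mul {k : J2 → ℝ} (hk : ContDiffOn ℝ ∞ k (hypDomain W F)) {K : J2 → ℝ}
    (hK : ∀ w ∈ hypDomain W F, K w = lamPlus F w * k w) {w : J2} (hw : w ∈ hypDomain W F)
    (i : Fin 8) : pd i K w = lamPlus F w * pd i k w + k w * pd i (lamPlus F) w := by
  have ho := isOpen_hypDomain hW hF
  have h1 := ((contDiffOn_lamPlus hW hF).contDiffAt (ho.mem_nhds hw)).differentiableAt (by simp)
  have h2 := (hk.contDiffAt (ho.mem_nhds hw)).differentiableAt (by simp)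
  have hev : K =ᶠ[𝓝 w] fun w => lamPlus F w * k w := by
    filter_upwards [ho.mem_nhds hw] with v hv using hK v hv
  simp only [pd]
  rw [hev.fderiv_eq, fderiv_fun_mul h1 h2]
  simp

/-- The compatibility condition between the derivatives of the two characteristic coefficients
that follows from the symmetry of the second derivatives of `F`. -/
lemma coef_compat {w : J2} (hw : w ∈ hypDomain W F) :
    pd 5 (gCoef F) w - hCoef F w * pd 6 (gCoef F) w + hCoef F w ^ 2 * pd 7 (gCoef F) w =
    gCoef F w ^ 2 * pd 5 (hCoef F) w - gCoef F w * pd 6 (hCoef F) w + pd 7 (hCoef F) w := by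
  have hg := contDiffOn_gCoef hW hF
  have hh := contDiffOn_hCoef hW hF
  have ho := isOpen_hypDomain hW hF
  have hgw := (hg.contDiffAt (ho.mem_nhds hw)).differentiableAt (by simp)
  have hhw := (hh.contDiffAt (ho.mem_nhds hw)).differentiableAt (by simp)
  have cr := pd_lam_mul hW hF hh (K := Fr F) (fun v hv => (coef_spec hv).1) hw
  have ct := pd_lam_mul hW hF hg (K := Ft F) (fun v hv => (coef_spec hv).2.1) hw
  have cs := pd_lam_mul hW hF (contDiffOn_const.add (hg.mul hh)) (K := Fs F)
    (fun v hv => (coef_spec hv).2.2.1) hw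
  have cgh : ∀ i, pd i (fun v => 1 + gCoef F v * hCoef F v) w =
      gCoef F w * pd i (hCoef F) w + hCoef F w * pd i (gCoef F) w := by
    intro i
    simp only [pd, fderiv_const_add, fderiv_fun_mul hgw hhw]
    simp
  have E1 := pd_pd_comm hW hF hw.1 6 5
  have E2 := pd_pd_comm hW hF hw.1 7 5
  have E3 := pd_pd_comm hW hF hw.1 7 6
  rw [cr, cs, cgh] at E1
  rw [cr, ct] at E2
  rw [cs, ct, cgh] at E3
  refine mul_left_cancel₀ hw.2.2.ne' ?_
  -- The multipliers g, -(1 + gh), h are chosen so that all derivatives of λ₊ cancel.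
  linear_combination gCoef F w * E1 - (1 + gCoef F w * hCoef F w) * E2 + hCoef F w * E3

-- Up to the factor -λ₊², I₁ is the derivative of g along (g², -g, 1) and I₂ that of h along (1, -h,
-- h²), in the coordinates (r, s, t). These two directions span the kernel of dF on the fibres of J²
-- → J¹; `coef_compat` equates the two cross derivatives.
omit hW hF in
lemma relInv_eq {w : J2} (hw : w ∈ hypDomain W F) :
    relInv1 F w = -lamPlus F w ^ 2 * (gCoef F w ^ 2 * pd 5 (gCoef F) w -
      gCoef F w * pd 6 (gCoef F) w + pd 7 (gCoef F) w) ∧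
    relInv2 F w = -lamPlus F w ^ 2 * (pd 5 (hCoef F) w - hCoef F w * pd 6 (hCoef F) w +
      hCoef F w ^ 2 * pd 7 (hCoef F) w) := by
  obtain ⟨h1, h2, h3, -⟩ := coef_spec hw
  have e1 : (fun v => Ft F v / lamPlus F v) = gCoef F := rfl
  have e2 : (fun v => Fr F v / lamPlus F v) = hCoef F := rfl
  constructor
  · simp only [relInv1, e1, Matrix.det_fin_three]
    simp [h1, h2, h3]
    ring
  · simp only [relInv2, e2, Matrix.det_fin_three]
    simp [h1, h2, h3]
    ring

end Hyp

/-! ### The characteristic coframe and its torsion -/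

section Coframe

variable (F : J2 → ℝ) (iF : E7 → J2)

/-- `1 - g h` along the parametrization. -/
def uFun (x : E7) : ℝ := 1 - gCoef F (iF x) * hCoef F (iF x)

/-- The coefficient of `dx` in `dF` modulo the contact forms, divided by `λ₊`. -/
def xCoef (w : J2) : ℝ :=
  (pd 0 F w + w 3 * pd 2 F w + w 5 * pd 3 F w + w 6 * pd 4 F w) / lamPlus F w

/-- The coefficient of `dy` in `dF` modulo the contact forms, divided by `λ₊`. -/
def yCoef (w : J2) : ℝ :=
  (pd 1 F w + w 4 * pd 2 F w + w 6 * pd 3 F w + w 7 * pd 4 F w) / lamPlus F w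

/-- The form `(dx - h dy) / (1 - g h)`. -/
def aForm (x : E7) : Cov :=
  (uFun F iF x)⁻¹ • (dcoord iF 0 x - hCoef F (iF x) • dcoord iF 1 x)

/-- The form `(dy - g dx) / (1 - g h)`. -/
def bForm (x : E7) : Cov :=
  (uFun F iF x)⁻¹ • (dcoord iF 1 x - gCoef F (iF x) • dcoord iF 0 x)

/-- The coframe induced by the characteristic systems of a hyperbolic equation. -/
def charCoframe : Fin 7 → E7 → Cov :=
  ![fun x => (-1 : ℝ) • contactForm iF 0 x,
    fun x => contactForm iF 1 x + gCoef F (iF x) • contactForm iF 2 x,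
    fun x => hCoef F (iF x) • contactForm iF 1 x + contactForm iF 2 x,
    aForm F iF,
    fun x => dcoord iF 5 x + (2 * gCoef F (iF x)) • dcoord iF 6 x +
      (gCoef F (iF x) ^ 2) • dcoord iF 7 x +
      (xCoef F (iF x) + gCoef F (iF x) * yCoef F (iF x)) • bForm F iF x,
    bForm F iF,
    fun x => (hCoef F (iF x) ^ 2) • dcoord iF 5 x + (2 * hCoef F (iF x)) • dcoord iF 6 x +
      dcoord iF 7 x + (hCoef F (iF x) * xCoef F (iF x) + yCoef F (iF x)) • aForm F iF x]

/-- The torsion form of the first characteristic system. -/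
def gTorsion (x : E7) : Cov := (uFun F iF x)⁻¹ • (((pd 4 F (iF x) - gCoef F (iF x) *
  pd 3 F (iF x)) / lamPlus F (iF x)) • bForm F iF x - fderiv ℝ (fun x => gCoef F (iF x)) x)

/-- The torsion form of the second characteristic system. -/
def hTorsion (x : E7) : Cov := (uFun F iF x)⁻¹ • (((pd 3 F (iF x) - hCoef F (iF x) *
  pd 4 F (iF x)) / lamPlus F (iF x)) • aForm F iF x - fderiv ℝ (fun x => hCoef F (iF x)) x)

end Coframe

namespace IsNondegParam

variable {W : Set J2} {F : J2 → ℝ} {S : Set E7} {iF : E7 → J2} (H : IsNondegParam W F S iF)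
include H

lemma contDiffAt {x : E7} (hx : x ∈ S) : ContDiffAt ℝ ∞ iF x :=
  H.smooth_i.contDiffAt (H.isOpen_S.mem_nhds hx)

lemma contDiffOn_dcoord (i : Fin 8) : ContDiffOn ℝ ∞ (dcoord iF i) S :=
  contDiffOn_const.clm_comp (H.smooth_i.fderiv_of_isOpen H.isOpen_S (by simp))

lemma contDiffOn_coord (i : Fin 8) : ContDiffOn ℝ ∞ (fun x => iF x i) S :=
  contDiffOn_pi.1 H.smooth_i i

lemma contDiffOn_contactForm (α : Fin 3) : ContDiffOn ℝ ∞ (contactForm iF α) S := by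
  refine contDiffOn_clm_apply.2 fun X => ?_
  have hc := H.contDiffOn_coord
  have hd := fun i => (H.contDiffOn_dcoord i).clm_apply (contDiffOn_const (c := X))
  fin_cases α
  · exact (((hd 2).sub ((hc 3).mul (hd 0))).sub ((hc 4).mul (hd 1))).congr
      fun x _ => (contactForm_apply iF x X).1
  · exact (((hd 3).sub ((hc 5).mul (hd 0))).sub ((hc 6).mul (hd 1))).congr
      fun x _ => (contactForm_apply iF x X).2.1
  · exact (((hd 4).sub ((hc 6).mul (hd 0))).sub ((hc 7).mul (hd 1))).congr
      fun x _ => (contactForm_apply iF x X).2.2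

/-- The linear relation between the pulled back coordinate differentials. -/
lemma relation {x : E7} (hx : x ∈ S) (X : E7) :
    ∑ i, pd i F (iF x) * dcoord iF i x X = 0 := by
  have h1 : DifferentiableAt ℝ F (iF x) :=
    (H.smooth_F.contDiffAt (H.isOpen_W.mem_nhds (H.maps hx))).differentiableAt (by simp)
  rw [← fderiv_comp_apply h1 ((H.contDiffAt hx).differentiableAt (by simp))]
  have hev : (fun x => F (iF x)) =ᶠ[𝓝 x] fun _ => 0 := by
    filter_upwards [H.isOpen_S.mem_nhds hx] with y hy using H.locus y hy
  rw [hev.fderiv_eq]; simp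

/-- The part of the parameter domain where `λ₊ > 0`. -/
lemma isOpen_dom : IsOpen (S ∩ iF ⁻¹' hypDomain W F) :=
  H.smooth_i.continuousOn.isOpen_inter_preimage H.isOpen_S (isOpen_hypDomain H.isOpen_W H.smooth_F)

lemma contDiffOn_comp {k : J2 → ℝ} (hk : ContDiffOn ℝ ∞ k (hypDomain W F)) :
    ContDiffOn ℝ ∞ (fun x => k (iF x)) (S ∩ iF ⁻¹' hypDomain W F) :=
  hk.comp (H.smooth_i.mono Set.inter_subset_left) fun _ hx => hx.2

/-- The relation in terms of the characteristic coefficients. -/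
lemma relation_of_contactForm_eq_zero {x : E7} (hx : x ∈ S ∩ iF ⁻¹' hypDomain W F) {X : E7}
    (h0 : contactForm iF 0 x X = 0) :
    hCoef F (iF x) * dcoord iF 5 x X + (1 + gCoef F (iF x) * hCoef F (iF x)) * dcoord iF 6 x X +
      gCoef F (iF x) * dcoord iF 7 x X =
    -(xCoef F (iF x) * dcoord iF 0 x X + yCoef F (iF x) * dcoord iF 1 x X +
      (pd 3 F (iF x) / lamPlus F (iF x)) * contactForm iF 1 x X +
      (pd 4 F (iF x) / lamPlus F (iF x)) * contactForm iF 2 x X) := by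
  have hr := H.relation hx.1 X
  obtain ⟨h1, h2, h3, -⟩ := coef_spec hx.2
  obtain ⟨c0, c1, c2⟩ := contactForm_apply iF x X
  have hl : lamPlus F (iF x) ≠ 0 := hx.2.2.2.ne'
  rw [Fin.sum_univ_eight] at hr
  change pd 5 F (iF x) = _ at h1
  change pd 7 F (iF x) = _ at h2
  change pd 6 F (iF x) = _ at h3
  rw [h0] at c0
  rw [c1, c2, xCoef, yCoef]
  field_simp
  linear_combination hr - dcoord iF 5 x X * h1 - dcoord iF 7 x X * h2 - dcoord iF 6 x X * h3 +
    pd 2 F (iF x) * c0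

omit H in
lemma dcoord_eq {x : E7} (hu : uFun F iF x ≠ 0) (X : E7) :
    dcoord iF 0 x X = aForm F iF x X + hCoef F (iF x) * bForm F iF x X ∧
    dcoord iF 1 x X = gCoef F (iF x) * aForm F iF x X + bForm F iF x X := by
  simp only [aForm, bForm, sub_apply, smul_apply, smul_eq_mul]
  constructor <;> field_simp <;> rw [uFun] <;> ring

omit H in
lemma uFun_pos {x : E7} (hx : x ∈ S ∩ iF ⁻¹' hypDomain W F) : 0 < uFun F iF x :=
  (coef_spec hx.2).2.2.2

/-- Reconstruction of the coordinate differentials from the characteristic coframe. -/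
lemma dcoord_solve {x : E7} (hx : x ∈ S ∩ iF ⁻¹' hypDomain W F) {X : E7}
    (h : ∀ i : Fin 7, i ≠ 4 → i ≠ 6 → charCoframe F iF i x X = 0) :
    (∀ i : Fin 8, i < 5 → dcoord iF i x X = 0) ∧
    uFun F iF x ^ 2 * dcoord iF 5 x X =
      charCoframe F iF 4 x X + gCoef F (iF x) ^ 2 * charCoframe F iF 6 x X ∧
    uFun F iF x ^ 2 * dcoord iF 6 x X =
      -hCoef F (iF x) * charCoframe F iF 4 x X - gCoef F (iF x) * charCoframe F iF 6 x X ∧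
    uFun F iF x ^ 2 * dcoord iF 7 x X =
      hCoef F (iF x) ^ 2 * charCoframe F iF 4 x X + charCoframe F iF 6 x X := by
  have hu := (uFun_pos hx).ne'
  have e0 := h 0 (by decide) (by decide)
  have e1 := h 1 (by decide) (by decide)
  have e2 := h 2 (by decide) (by decide)
  have e3 := h 3 (by decide) (by decide)
  have e5 := h 5 (by decide) (by decide)
  simp only [charCoframe, Matrix.cons_val, add_apply, smul_apply, smul_eq_mul] at e0 e1 e2 e3 e5 ⊢
  obtain ⟨d0, d1⟩ := dcoord_eq hu X
  rw [e3, e5] at d0 d1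
  simp only [mul_zero, add_zero] at d0 d1
  have t0 : contactForm iF 0 x X = 0 := by linarith
  -- The forms θ² + gθ³ and hθ² + θ³ have determinant 1 - gh ≠ 0.
  have t2 : contactForm iF 2 x X = 0 := by
    refine (mul_eq_zero.1 (?_ : uFun F iF x * _ = 0)).resolve_left hu
    rw [uFun]; linear_combination e2 - hCoef F (iF x) * e1
  have t1 : contactForm iF 1 x X = 0 := by rw [t2] at e1; linarith
  have hr := H.relation_of_contactForm_eq_zero hx t0
  obtain ⟨c0, c1, c2⟩ := contactForm_apply iF x X
  rw [t1, t2, d0, d1] at hr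
  rw [t0, d0, d1] at c0
  rw [t1, d0, d1] at c1
  rw [t2, d0, d1] at c2
  refine ⟨?_, ?_, ?_, ?_⟩
  · intro i hi
    fin_cases i
    · exact d0
    · exact d1
    · change dcoord iF 2 x X = 0; linarith
    · change dcoord iF 3 x X = 0; linarith
    · change dcoord iF 4 x X = 0; linarith
    all_goals exact absurd hi (by decide)
  · rw [e3, e5, uFun]; linear_combination -2 * gCoef F (iF x) * hr
  · rw [e3, e5, uFun]; linear_combination (1 + gCoef F (iF x) * hCoef F (iF x)) * hr
  · rw [e3, e5, uFun]; linear_combination -2 * hCoef F (iF x) * hr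

omit H in
lemma span_contact {x : E7} (hx : x ∈ S ∩ iF ⁻¹' hypDomain W F) : contactSystem iF x =
    Submodule.span ℝ {charCoframe F iF 0 x, charCoframe F iF 1 x, charCoframe F iF 2 x} := by
  have hu := (uFun_pos hx).ne'
  rw [contactSystem_eq]
  simp only [charCoframe, Matrix.cons_val]
  apply le_antisymm <;> rw [Submodule.span_le] <;> rintro ξ (rfl | rfl | rfl) <;>
    refine Submodule.mem_span_triple.2 ?_
  · exact ⟨-1, 0, 0, by ext X; simp⟩
  · refine ⟨0, (uFun F iF x)⁻¹, -(uFun F iF x)⁻¹ * gCoef F (iF x), ?_⟩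
    ext X
    simp
    field_simp
    rw [uFun]; ring
  · refine ⟨0, -(uFun F iF x)⁻¹ * hCoef F (iF x), (uFun F iF x)⁻¹, ?_⟩
    ext X
    simp
    field_simp
    rw [uFun]; ring
  · exact ⟨-1, 0, 0, by ext X; simp⟩
  · exact ⟨0, 1, gCoef F (iF x), by simp⟩
  · exact ⟨0, hCoef F (iF x), 1, by simp⟩

end IsNondegParam

namespace IsNondegParam

variable {W : Set J2} {F : J2 → ℝ} {S : Set E7} {iF : E7 → J2} (H : IsNondegParam W F S iF)
include H

lemma contDiffOn_g : ContDiffOn ℝ ∞ (fun x => gCoef F (iF x)) (S ∩ iF ⁻¹' hypDomain W F) :=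
  H.contDiffOn_comp (contDiffOn_gCoef H.isOpen_W H.smooth_F)

lemma contDiffOn_h : ContDiffOn ℝ ∞ (fun x => hCoef F (iF x)) (S ∩ iF ⁻¹' hypDomain W F) :=
  H.contDiffOn_comp (contDiffOn_hCoef H.isOpen_W H.smooth_F)

lemma contDiffOn_lam : ContDiffOn ℝ ∞ (fun x => lamPlus F (iF x)) (S ∩ iF ⁻¹' hypDomain W F) :=
  H.contDiffOn_comp (contDiffOn_lamPlus H.isOpen_W H.smooth_F)

lemma contDiffOn_pdF (i : Fin 8) :
    ContDiffOn ℝ ∞ (fun x => pd i F (iF x)) (S ∩ iF ⁻¹' hypDomain W F) :=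
  H.contDiffOn_comp ((contDiffOn_pd H.isOpen_W H.smooth_F i).mono Set.inter_subset_left)

lemma contDiffOn_u : ContDiffOn ℝ ∞ (uFun F iF) (S ∩ iF ⁻¹' hypDomain W F) :=
  contDiffOn_const.sub (H.contDiffOn_g.mul H.contDiffOn_h)

lemma contDiffOn_uinv :
    ContDiffOn ℝ ∞ (fun x => (uFun F iF x)⁻¹) (S ∩ iF ⁻¹' hypDomain W F) :=
  H.contDiffOn_u.inv fun _ hx => (uFun_pos hx).ne'

lemma contDiffOn_xCoef :
    ContDiffOn ℝ ∞ (fun x => xCoef F (iF x)) (S ∩ iF ⁻¹' hypDomain W F) := by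
  have hp := H.contDiffOn_pdF
  have hc := fun i => (H.contDiffOn_coord i).mono
    (Set.inter_subset_left : S ∩ iF ⁻¹' hypDomain W F ⊆ S)
  exact ((((hp 0).add ((hc 3).mul (hp 2))).add ((hc 5).mul (hp 3))).add ((hc 6).mul (hp 4))).div
    H.contDiffOn_lam fun x hx => hx.2.2.2.ne'

lemma contDiffOn_yCoef :
    ContDiffOn ℝ ∞ (fun x => yCoef F (iF x)) (S ∩ iF ⁻¹' hypDomain W F) := by
  have hp := H.contDiffOn_pdF
  have hc := fun i => (H.contDiffOn_coord i).mono
    (Set.inter_subset_left : S ∩ iF ⁻¹' hypDomain W F ⊆ S)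
  exact ((((hp 1).add ((hc 4).mul (hp 2))).add ((hc 6).mul (hp 3))).add ((hc 7).mul (hp 4))).div
    H.contDiffOn_lam fun x hx => hx.2.2.2.ne'

lemma contDiffOn_dcoord_dom (i : Fin 8) :
    ContDiffOn ℝ ∞ (dcoord iF i) (S ∩ iF ⁻¹' hypDomain W F) :=
  (H.contDiffOn_dcoord i).mono Set.inter_subset_left

lemma contDiffOn_aForm : ContDiffOn ℝ ∞ (aForm F iF) (S ∩ iF ⁻¹' hypDomain W F) :=
  H.contDiffOn_uinv.smul ((H.contDiffOn_dcoord_dom 0).sub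
    (H.contDiffOn_h.smul (H.contDiffOn_dcoord_dom 1)))

lemma contDiffOn_bForm : ContDiffOn ℝ ∞ (bForm F iF) (S ∩ iF ⁻¹' hypDomain W F) :=
  H.contDiffOn_uinv.smul ((H.contDiffOn_dcoord_dom 1).sub
    (H.contDiffOn_g.smul (H.contDiffOn_dcoord_dom 0)))

/-- By `dcoord_solve`, a vector killed by the seven forms is killed by all pulled back coordinate
differentials, hence is zero because the parametrization has rank 7. -/
lemma isCoframe_charCoframe : IsCoframe (S ∩ iF ⁻¹' hypDomain W F) (charCoframe F iF) := by
  have hθ := fun α => (H.contDiffOn_contactForm α).mono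
    (Set.inter_subset_left : S ∩ iF ⁻¹' hypDomain W F ⊆ S)
  have hd := H.contDiffOn_dcoord_dom
  have hg := H.contDiffOn_g
  have hh := H.contDiffOn_h
  have hx := H.contDiffOn_xCoef
  have hy := H.contDiffOn_yCoef
  refine ⟨H.isOpen_dom, fun i => ?_, fun x hx => ?_⟩
  · fin_cases i
    exacts [(hθ 0).const_smul (-1 : ℝ), (hθ 1).add (hg.smul (hθ 2)), (hh.smul (hθ 1)).add (hθ 2),
      H.contDiffOn_aForm,
      (((hd 5).add ((contDiffOn_const.mul hg).smul (hd 6))).add ((hg.pow 2).smul (hd 7))).add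
        ((hx.add (hg.mul hy)).smul H.contDiffOn_bForm),
      H.contDiffOn_bForm,
      ((((hh.pow 2).smul (hd 5)).add ((contDiffOn_const.mul hh).smul (hd 6))).add (hd 7)).add
        (((hh.mul hx).add hy).smul H.contDiffOn_aForm)]
  · rw [linearIndependent_iff_ker]
    intro X hX
    obtain ⟨h1, h5, h6, h7⟩ := H.dcoord_solve hx (X := X) fun i _ _ => hX i
    have hu : uFun F iF x ^ 2 ≠ 0 := pow_ne_zero 2 (uFun_pos hx).ne'
    simp only [hX, mul_zero, add_zero, sub_zero] at h5 h6 h7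
    have h5' := (mul_eq_zero.1 h5).resolve_left hu
    have h6' := (mul_eq_zero.1 h6).resolve_left hu
    have h7' := (mul_eq_zero.1 h7).resolve_left hu
    refine H.rank x hx.1 ?_
    rw [map_zero]
    ext i
    change dcoord iF i x X = 0
    fin_cases i
    exacts [h1 0 (by decide), h1 1 (by decide), h1 2 (by decide), h1 3 (by decide),
      h1 4 (by decide), h5', h6', h7']

/-- Substituting dx = a + h b and dy = g a + b, the differential of θ² + gθ³ is a∧(dr + 2g ds + g²
dt) + b∧(h dr + (1 + gh) ds + g dt) + dg∧θ³. The relation dF = 0 rewrites the second bracket through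
dx, dy and contact forms: its dx, dy part completes the fifth form of the coframe, and its contact
part joins dg in the torsion. The other system is symmetric. -/
lemma isTorsionCoframe : IsTorsionCoframe iF (S ∩ iF ⁻¹' hypDomain W F) (charCoframe F iF)
    (gTorsion F iF) (hTorsion F iF) := by
  have ho := H.isOpen_dom
  have hp := H.contDiffOn_pdF
  have hg := H.contDiffOn_g
  have hh := H.contDiffOn_h
  have hdiff : ∀ {k : E7 → ℝ}, ContDiffOn ℝ ∞ k (S ∩ iF ⁻¹' hypDomain W F) →
      ∀ x ∈ S ∩ iF ⁻¹' hypDomain W F, DifferentiableAt ℝ k x := fun hk x hx =>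
    (hk.contDiffAt (ho.mem_nhds hx)).differentiableAt (by simp)
  have hθ : ∀ α, ∀ x ∈ S, DifferentiableAt ℝ (contactForm iF α) x := fun α x hx =>
    ((H.contDiffOn_contactForm α).contDiffAt (H.isOpen_S.mem_nhds hx)).differentiableAt (by simp)
  refine ⟨H.isCoframe_charCoframe, fun x hx => span_contact hx, ?_, ?_, ?_, ?_, ?_⟩
  · exact H.contDiffOn_uinv.smul (((((hp 4).sub (hg.mul (hp 3))).div H.contDiffOn_lam
      fun x hx => hx.2.2.2.ne').smul H.contDiffOn_bForm).sub (hg.fderiv_of_isOpen ho (by simp)))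
  · exact H.contDiffOn_uinv.smul (((((hp 3).sub (hh.mul (hp 4))).div H.contDiffOn_lam
      fun x hx => hx.2.2.2.ne').smul H.contDiffOn_aForm).sub (hh.fderiv_of_isOpen ho (by simp)))
  · intro x hx X Y hX hY
    obtain ⟨dX0, dX1⟩ := dcoord_eq (uFun_pos hx).ne' X
    obtain ⟨dY0, dY1⟩ := dcoord_eq (uFun_pos hx).ne' Y
    simp only [charCoframe, Matrix.cons_val, smul_apply, smul_eq_mul] at hX hY ⊢
    have cX := contactForm_apply iF x X
    have cY := contactForm_apply iF x Y
    rw [extD_smul (differentiableAt_const _) (hθ 0 x hx.1),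
      (extD_contactForm (H.contDiffAt hx.1) X Y).1]
    simp only [wdg, add_apply, smul_apply, smul_eq_mul, fderiv_fun_const, Pi.zero_apply,
      zero_apply, dX0, dX1, dY0, dY1] at cX cY ⊢
    obtain ⟨-, cX1, cX2⟩ := cX
    obtain ⟨-, cY1, cY2⟩ := cY
    rw [cX1, cX2, cY1, cY2]
    ring
  · intro x hx X Y hX hY hX' hY'
    have hu := (uFun_pos hx).ne'
    obtain ⟨dX0, dX1⟩ := dcoord_eq hu X
    obtain ⟨dY0, dY1⟩ := dcoord_eq hu Y
    simp only [charCoframe, Matrix.cons_val, add_apply, smul_apply, smul_eq_mul] at hX hY hX' hY' ⊢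
    have RX := H.relation_of_contactForm_eq_zero hx (X := X) (by linarith)
    have RY := H.relation_of_contactForm_eq_zero hx (X := Y) (by linarith)
    obtain ⟨-, e1, e2⟩ := extD_contactForm (H.contDiffAt hx.1) X Y
    have e := extD_add (hθ 1 x hx.1) ((hdiff hg x hx).fun_smul (hθ 2 x hx.1)) X Y
    rw [extD_smul (hdiff hg x hx) (hθ 2 x hx.1), e1, e2] at e
    rw [e]
    have wX : contactForm iF 1 x X = -gCoef F (iF x) * contactForm iF 2 x X := by linarith
    have wY : contactForm iF 1 x Y = -gCoef F (iF x) * contactForm iF 2 x Y := by linarith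
    -- Modulo θ² + gθ³ one has hθ² + θ³ = (1 - gh) θ³, which cancels the factor (1 - gh)⁻¹ of
    -- `gTorsion`.
    have key : wdg (hCoef F (iF x) • contactForm iF 1 x + contactForm iF 2 x)
        (gTorsion F iF x) X Y = wdg (contactForm iF 2 x) (((pd 4 F (iF x) - gCoef F (iF x) *
          pd 3 F (iF x)) / lamPlus F (iF x)) • bForm F iF x -
          fderiv ℝ (fun x => gCoef F (iF x)) x) X Y := by
      simp only [wdg, gTorsion, add_apply, sub_apply, smul_apply, smul_eq_mul, wX, wY]
      field_simp
      rw [uFun]; ring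
    rw [key]
    simp only [wdg, add_apply, sub_apply, smul_apply, smul_eq_mul, dX0, dX1, dY0, dY1, wX, wY]
      at RX RY ⊢
    linear_combination bForm F iF x X * RY - bForm F iF x Y * RX
  · intro x hx X Y hX hY hX' hY'
    have hu := (uFun_pos hx).ne'
    obtain ⟨dX0, dX1⟩ := dcoord_eq hu X
    obtain ⟨dY0, dY1⟩ := dcoord_eq hu Y
    simp only [charCoframe, Matrix.cons_val, add_apply, smul_apply, smul_eq_mul] at hX hY hX' hY' ⊢
    have RX := H.relation_of_contactForm_eq_zero hx (X := X) (by linarith)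
    have RY := H.relation_of_contactForm_eq_zero hx (X := Y) (by linarith)
    obtain ⟨-, e1, e2⟩ := extD_contactForm (H.contDiffAt hx.1) X Y
    have e := extD_add ((hdiff hh x hx).fun_smul (hθ 1 x hx.1)) (hθ 2 x hx.1) X Y
    rw [extD_smul (hdiff hh x hx) (hθ 1 x hx.1), e1, e2] at e
    rw [e]
    have wX : contactForm iF 2 x X = -hCoef F (iF x) * contactForm iF 1 x X := by linarith
    have wY : contactForm iF 2 x Y = -hCoef F (iF x) * contactForm iF 1 x Y := by linarith
    have key : wdg (contactForm iF 1 x + gCoef F (iF x) • contactForm iF 2 x)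
        (hTorsion F iF x) X Y = wdg (contactForm iF 1 x) (((pd 3 F (iF x) - hCoef F (iF x) *
          pd 4 F (iF x)) / lamPlus F (iF x)) • aForm F iF x -
          fderiv ℝ (fun x => hCoef F (iF x)) x) X Y := by
      simp only [wdg, hTorsion, add_apply, sub_apply, smul_apply, smul_eq_mul, wX, wY]
      field_simp
      rw [uFun]; ring
    rw [key]
    simp only [wdg, add_apply, sub_apply, smul_apply, smul_eq_mul, dX0, dX1, dY0, dY1, wX, wY]
      at RX RY ⊢
    linear_combination aForm F iF x X * RY - aForm F iF x Y * RX

/-- The derivative along the parametrization in the directions where only `τ₁`, `τ₂` survive. -/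
lemma fderiv_coef {x : E7} (hx : x ∈ S ∩ iF ⁻¹' hypDomain W F) {k : J2 → ℝ}
    (hk : ContDiffOn ℝ ∞ k (hypDomain W F)) {X : E7}
    (h : ∀ i : Fin 7, i ≠ 4 → i ≠ 6 → charCoframe F iF i x X = 0) :
    uFun F iF x ^ 2 * fderiv ℝ (fun x => k (iF x)) x X =
      (pd 5 k (iF x) - hCoef F (iF x) * pd 6 k (iF x) + hCoef F (iF x) ^ 2 * pd 7 k (iF x)) *
        charCoframe F iF 4 x X +
      (gCoef F (iF x) ^ 2 * pd 5 k (iF x) - gCoef F (iF x) * pd 6 k (iF x) + pd 7 k (iF x)) *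
        charCoframe F iF 6 x X := by
  obtain ⟨h1, h5, h6, h7⟩ := H.dcoord_solve hx h
  rw [fderiv_comp_apply ((hk.contDiffAt ((isOpen_hypDomain H.isOpen_W H.smooth_F).mem_nhds
    hx.2)).differentiableAt (by simp)) ((H.contDiffAt hx.1).differentiableAt (by simp)),
    Fin.sum_univ_eight, h1 0 (by decide), h1 1 (by decide), h1 2 (by decide), h1 3 (by decide),
    h1 4 (by decide)]
  linear_combination pd 5 k (iF x) * h5 + pd 6 k (iF x) * h6 + pd 7 k (iF x) * h7

/-- The torsion coefficients in terms of the relative invariants. -/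
lemma torsion_eq {x : E7} (hx : x ∈ S ∩ iF ⁻¹' hypDomain W F) :
    gTorsion F iF x (dualFrame (charCoframe F iF) 4 x) =
      hTorsion F iF x (dualFrame (charCoframe F iF) 6 x) ∧
    gTorsion F iF x (dualFrame (charCoframe F iF) 6 x) * (uFun F iF x ^ 3 *
      lamPlus F (iF x) ^ 2) = relInv1 F (iF x) ∧
    hTorsion F iF x (dualFrame (charCoframe F iF) 4 x) * (uFun F iF x ^ 3 *
      lamPlus F (iF x) ^ 2) = relInv2 F (iF x) := by
  have C := H.isCoframe_charCoframe
  have v := fun i j => C.apply_dualFrame hx i j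
  have hu := (uFun_pos hx).ne'
  have n4 : ∀ i : Fin 7, i ≠ 4 → i ≠ 6 →
      charCoframe F iF i x (dualFrame (charCoframe F iF) 4 x) = 0 := fun i hi _ => by simp [v, hi]
  have n6 : ∀ i : Fin 7, i ≠ 4 → i ≠ 6 →
      charCoframe F iF i x (dualFrame (charCoframe F iF) 6 x) = 0 := fun i _ hi => by simp [v, hi]
  have hg := contDiffOn_gCoef H.isOpen_W H.smooth_F
  have hh := contDiffOn_hCoef H.isOpen_W H.smooth_F
  have g4 := H.fderiv_coef hx hg n4
  have g6 := H.fderiv_coef hx hg n6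
  have h4 := H.fderiv_coef hx hh n4
  have h6 := H.fderiv_coef hx hh n6
  simp [v] at g4 g6 h4 h6
  have a4 : aForm F iF x (dualFrame (charCoframe F iF) 4 x) = 0 := n4 3 (by decide) (by decide)
  have a6 : aForm F iF x (dualFrame (charCoframe F iF) 6 x) = 0 := n6 3 (by decide) (by decide)
  have b4 : bForm F iF x (dualFrame (charCoframe F iF) 4 x) = 0 := n4 5 (by decide) (by decide)
  have b6 : bForm F iF x (dualFrame (charCoframe F iF) 6 x) = 0 := n6 5 (by decide) (by decide)
  have hc := coef_compat H.isOpen_W H.smooth_F hx.2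
  obtain ⟨r1, r2⟩ := relInv_eq hx.2
  simp only [gTorsion, hTorsion, sub_apply, smul_apply, smul_eq_mul, a4, a6, b4, b6, mul_zero,
    zero_sub]
  refine ⟨?_, ?_, ?_⟩
  -- On the dual vectors 4 and 6 the forms a and b vanish, so only the derivatives of g and h
  -- remain, and these are the two cross derivatives of `coef_compat`.
  · congr 2
    refine mul_left_cancel₀ (pow_ne_zero 2 hu) ?_
    rw [g4, h6, hc]
  · rw [r1]; field_simp; linear_combination -lamPlus F (iF x) ^ 2 * g6
  · rw [r2]; field_simp; linear_combination -lamPlus F (iF x) ^ 2 * h4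

end IsNondegParam

/-! ### Generic hyperbolic equations and the conclusion -/

namespace IsGenericHyperbolic

variable {W : Set J2} {F : J2 → ℝ} {S : Set E7} {iF : E7 → J2}

/-- Δ is quadratic in F, and the contact system and its characteristic systems depend on the
parametrization alone; F_s changes sign. -/
lemma neg (H : IsGenericHyperbolic W F S iF) : IsGenericHyperbolic W (-F) S iF := by
  refine ⟨⟨H.isOpen_W, H.smooth_F.neg, H.isOpen_S, H.smooth_i, H.maps, fun p hp => ?_, H.rank,
    H.transverse⟩, fun p hp => ?_, H.generic⟩
  · simp [H.locus p hp]
  · have := H.hyperbolic p hp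
    simpa [discr, pd, fderiv_neg] using this

/-- Existence of adapted coframes, with the sign given by the relative invariants. -/
lemma exists_isWeakCoframe (H : IsGenericHyperbolic W F S iF) {p : E7} (hp : p ∈ S)
    (hs : 0 ≤ Fs F (iF p)) :
    ∃ V om, p ∈ V ∧ V ⊆ S ∧ IsWeakCoframe iF V om
      (Real.sign (relInv1 F (iF p) * relInv2 F (iF p))) := by
  have hd := H.hyperbolic p hp
  have hx : p ∈ S ∩ iF ⁻¹' hypDomain W F := by
    refine ⟨hp, H.maps hp, hd, ?_⟩
    have : 0 < √|discr F (iF p)| := Real.sqrt_pos.2 (abs_pos.2 hd.ne)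
    rw [lamPlus]; positivity
  have T := H.isTorsionCoframe
  obtain ⟨-, t1, t2⟩ := H.torsion_eq hx
  -- Class 7 of both characteristic systems enters exactly here.
  have n1 : gTorsion F iF p (dualFrame (charCoframe F iF) 6 p) ≠ 0 := fun h0 =>
    T.classAt_ne hx h0 (H.generic _ _ Set.inter_subset_left T.isCharSystem p hx)
  have n2 : hTorsion F iF p (dualFrame (charCoframe F iF) 4 p) ≠ 0 := fun h0 =>
    T.swap.classAt_ne hx (by rw [T.dualFrame_swap hx, h0])
      (H.generic _ _ Set.inter_subset_left T.swap.isCharSystem p hx)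
  set k1 := gTorsion F iF p (dualFrame (charCoframe F iF) 6 p)
  set k2 := hTorsion F iF p (dualFrame (charCoframe F iF) 4 p)
  have hu := IsNondegParam.uFun_pos hx
  have hl : 0 < lamPlus F (iF p) := hx.2.2.2
  have hc : 0 < uFun F iF p ^ 3 * lamPlus F (iF p) ^ 2 := by positivity
  have hsign : (Real.sign (relInv1 F (iF p) * relInv2 F (iF p)) = 1 ∨
      Real.sign (relInv1 F (iF p) * relInv2 F (iF p)) = -1) ∧
      0 < Real.sign (relInv1 F (iF p) * relInv2 F (iF p)) * (k1 * k2) := by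
    have e : relInv1 F (iF p) * relInv2 F (iF p) =
        (uFun F iF p ^ 3 * lamPlus F (iF p) ^ 2) ^ 2 * (k1 * k2) := by
      rw [← t1, ← t2]; ring
    have hc2 := pow_pos hc 2
    rcases lt_or_gt_of_ne (mul_ne_zero n1 n2) with h | h
    · rw [e, Real.sign_of_neg (mul_neg_of_pos_of_neg hc2 h)]
      exact ⟨Or.inr rfl, by linarith⟩
    · rw [e, Real.sign_of_pos (mul_pos hc2 h)]
      exact ⟨Or.inl rfl, by linarith⟩
  obtain ⟨V, om, hpV, hV, hW⟩ := T.exists_isWeakCoframe (fun x hx => (H.torsion_eq hx).1)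
    hsign.1 hx hsign.2
  exact ⟨V, om, hpV, hV.trans Set.inter_subset_left, hW⟩

end IsGenericHyperbolic

end GenHyp

end

theorem mainTheorem5
    (W : Set GenHyp.J2) (F : GenHyp.J2 → ℝ) (S : Set GenHyp.E7) (iF : GenHyp.E7 → GenHyp.J2)
    (hF : GenHyp.IsGenericHyperbolic W F S iF) :
    -- near every point the sign exists and does not depend on the adapted coframe
    (∀ p ∈ S, ∃! ε : ℝ, GenHyp.IsEpsilonAt S iF p ε) ∧
    -- the sign is a contact invariant
    (∀ (W' : Set GenHyp.J2) (F' : GenHyp.J2 → ℝ) (S' : Set GenHyp.E7)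
        (iF' : GenHyp.E7 → GenHyp.J2), GenHyp.IsGenericHyperbolic W' F' S' iF' →
      ∀ (U : Set GenHyp.E7) (Φ : GenHyp.E7 → GenHyp.E7),
        GenHyp.IsContactEquiv S iF S' iF' U Φ →
      ∀ p ∈ U, ∀ ε ε' : ℝ, GenHyp.IsEpsilonAt S iF p ε →
        GenHyp.IsEpsilonAt S' iF' (Φ p) ε' → ε' = ε) ∧
    -- the sign equals `sgn (I₁ I₂)`, where `F` is replaced by `-F` if `F_s < 0`
    (∀ p ∈ S, ∀ ε : ℝ, GenHyp.IsEpsilonAt S iF p ε →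
      (0 ≤ GenHyp.Fs F (iF p) →
        ε = Real.sign (GenHyp.relInv1 F (iF p) * GenHyp.relInv2 F (iF p))) ∧
      (GenHyp.Fs F (iF p) ≤ 0 →
        ε = Real.sign (GenHyp.relInv1 (-F) (iF p) * GenHyp.relInv2 (-F) (iF p)))) := by
  refine ⟨fun p hp => ?_, ?_, fun p hp ε hε => ⟨fun hs => ?_, fun hs => ?_⟩⟩
  · have hex : ∃ ε, GenHyp.IsEpsilonAt S iF p ε := by
      rcases le_total 0 (GenHyp.Fs F (iF p)) with hs | hs
      · obtain ⟨V, om, hpV, hV, h⟩ := hF.exists_isWeakCoframe hp hs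
        exact ⟨_, V, om, hpV, hV, h.isAdaptedCoframe⟩
      · obtain ⟨V, om, hpV, hV, h⟩ := hF.neg.exists_isWeakCoframe hp (by
          simpa [GenHyp.pd, fderiv_neg] using hs)
        exact ⟨_, V, om, hpV, hV, h.isAdaptedCoframe⟩
    obtain ⟨ε, V, om, hpV, hV, h⟩ := hex
    refine ⟨ε, ⟨V, om, hpV, hV, h⟩, ?_⟩
    rintro ε' ⟨V', om', hpV', -, h'⟩
    exact h'.isWeakCoframe.sign_unique h.isWeakCoframe hpV' hpV
  · rintro W' F' S' iF' - U Φ hΦ p hp ε ε' ⟨V, om, hpV, -, h⟩ ⟨V', om', hpV', -, h'⟩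
    -- The pulled back coframe carries the sign ε' at p and is compared there with the given coframe
    -- of sign ε.
    exact (h'.isWeakCoframe.pullback hΦ).sign_unique h.isWeakCoframe ⟨hp, hpV'⟩ hpV
  · obtain ⟨V, om, hpV, -, h⟩ := hε
    obtain ⟨V', om', hpV', -, h'⟩ := hF.exists_isWeakCoframe hp hs
    exact h.isWeakCoframe.sign_unique h' hpV hpV'
  · obtain ⟨V, om, hpV, -, h⟩ := hε
    obtain ⟨V', om', hpV', -, h'⟩ := hF.neg.exists_isWeakCoframe hp (by
          simpa [GenHyp.pd, fderiv_neg] using hs)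
    exact h.isWeakCoframe.sign_unique h' hpV hpV'
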